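/- Let $k$ be a commutative ring, $\mathrm{VCL}$ a finite set (colors of vertices) and $\mathrm{FCL}$ any set (colors of flags). A *colored graph* $\Gamma$ consists of finite sets $V(\Gamma)$ (vertices) and $F(\Gamma)$ (flags), maps $\partial: F(\Gamma)\to V(\Gamma)$ and $s: F(\Gamma)\to F(\Gamma)$ with $s^2=\mathrm{id}$, and colorings $V(\Gamma)\to\mathrm{VCL}$, $c: F(\Gamma)\to\mathrm{FCL}$. A pair $\{f,s(f)\}$ with $f\ne s(f)$ is an inner edge; it is a *tadpole* if $\partial f=\partial s(f)$. For $J\subseteq V(\Gamma)$, the colored graph $\Gamma_J$ has the vertices in $J$ and all flags attached to them; its inner edges are the inner edges of $\Gamma$ with both ends in $J$, and all its other flags are external. For $J\neq\emptyset$ and $L\in\mathrm{VCL}$ the graph $\Gamma/(J,L)$ is obtained from $\Gamma$ by shrinking $J$ to one vertex $v_J$ of color $L$ and removing the inner edges of $\Gamma_J$. An *enumeration* of a graph with $n$ vertices is a bijection of its vertices with $\{1,\dots,n\}$. If $\Gamma$ is enumerated, $\Gamma_J$ and $\Gamma/(J,L)$ get the induced increasing enumerations, where $v_J$ is ordered by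 the least number in $J$. Let $\mathrm{Dgm}(n)$ be the set of isomorphism classes of enumerated colored graphs with $n$ vertices. For $n\ge 1$ let $U(n)=\mathrm{Hom}_k\bigl(k^{(\mathrm{Dgm}(n))},k^{(\mathrm{VCL})}\bigr)$, the space of *contraction maps*; write $Q(\Gamma)=\sum_{L\in\mathrm{VCL}}q(\Gamma,L)\,L$. The symmetric group $S_n$ acts on $U(n)$ from the right by $(Q\cdot\sigma)(\Gamma)=Q(\sigma\Gamma)$, where $\sigma\Gamma$ is $\Gamma$ with number $a$ replaced by $\sigma(a)$. For $Q''\in U(n)$, $Q'\in U(j)$ and $1\le i\le n$ let $Q''\circ_i Q'\in U(n-1+j)$ be $$(Q''\circ_i Q')(\Gamma)=\sum_{L\in\mathrm{VCL}}q'(\Gamma_J,L)\;Q''\bigl(\Gamma/(J,L)\bigr),$$ where $J$ is the set of the vertices with numbers $i,\dots,i+j-1$. With these operations $U=\{U(n)\}_{n\ge1}$ is a symmetric operad in the sense of partial compositions (equivariance and the sequential and parallel associativity laws hold; a unit is not required). Let $\mathrm{Adm}\subseteq\mathrm{FCL}\times\mathrm{FCL}$ be a symmetric subset. A colored graph $\Gamma$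 is *$\mathrm{Adm}$-admissible* if $(c(f),c(s(f)))\in\mathrm{Adm}$ for all flags $f$ with $f\neq s(f)$. Let $U_{\mathrm{Adm}}(n)\subseteq U(n)$ be the set of all contraction maps $Q$ such that $Q(\Gamma)=0$ for every $\Gamma$ that is not $\mathrm{Adm}$-admissible or has tadpoles. Then $U_{\mathrm{Adm}}=\{U_{\mathrm{Adm}}(n)\}_{n\ge1}$ is a suboperad of $U$: each $U_{\mathrm{Adm}}(n)$ is an $S_n$-invariant $k$-submodule of $U(n)$, and $Q''\circ_iQ'\in U_{\mathrm{Adm}}(n-1+j)$ for all $Q''\in U_{\mathrm{Adm}}(n)$, $Q'\in U_{\mathrm{Adm}}(j)$ and $1\le i\le n$. Moreover $U_{\mathrm{Adm}}$ is unital: there is $e\in U_{\mathrm{Adm}}(1)$ with $e\circ_1Q=Q$ and $Q\circ_ie=Q$ for all $n\ge 1$, $Q\in U_{\mathrm{Adm}}(n)$ and $1\le i\le n$. -/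

import Mathlib

universe u v w x

/-! ## Symmetric operads, by partial compositions -/

namespace OperadBlock

/-- Composing in slot `i` an operation with `n` inputs with one that has `j` inputs gives
`N = n - 1 + j` inputs. (All positions are counted from `0`.) The inputs `i, …, i + j - 1`, forming
the block, are those of the inner operation, the others are those of the outer one with `i` left
out, in the same order. -/
def place {n j N : ℕ} (h : N + 1 = n + j) (i : Fin n) :
    {a : Fin n // a ≠ i} ⊕ Fin j → Fin N
  | Sum.inl a =>
      if hlt : a.1.1 < i.1 then ⟨a.1.1, by omega⟩
      else ⟨a.1.1 + j - 1, by
        have h1 := a.1.2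
        have h2 : a.1.1 ≠ i.1 := fun e => a.2 (Fin.ext e)
        omega⟩
  | Sum.inr k => ⟨i.1 + k.1, by omega⟩

theorem place_bijective {n j N : ℕ} (h : N + 1 = n + j) (i : Fin n) :
    Function.Bijective (place h i) := by
  rw [Fintype.bijective_iff_injective_and_card]
  constructor
  · rintro (⟨a, ha⟩ | a) (⟨b, hb⟩ | b) hab
    · have h1 : a.1 ≠ i.1 := fun e => ha (Fin.ext e)
      have h2 : b.1 ≠ i.1 := fun e => hb (Fin.ext e)
      simp only [place] at hab
      have : a = b := by
        apply Fin.ext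
        split_ifs at hab <;> simp only [Fin.mk.injEq] at hab <;> omega
      subst this; rfl
    · exfalso
      have h1 : a.1 ≠ i.1 := fun e => ha (Fin.ext e)
      simp only [place] at hab
      split_ifs at hab <;> simp only [Fin.mk.injEq] at hab <;> omega
    · exfalso
      have h1 : b.1 ≠ i.1 := fun e => hb (Fin.ext e)
      simp only [place] at hab
      split_ifs at hab <;> simp only [Fin.mk.injEq] at hab <;> omega
    · simp only [place, Fin.mk.injEq] at hab
      congr 1
      apply Fin.ext; omega
  · have hi := i.2
    simp only [Fintype.card_sum, Fintype.card_fin, Fintype.card_subtype_compl,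
      Fintype.card_unique]
    omega

/-- The inputs of the composite in slot `i`, as a disjoint union. -/
noncomputable def placeEquiv {n j N : ℕ} (h : N + 1 = n + j) (i : Fin n) :
    {a : Fin n // a ≠ i} ⊕ Fin j ≃ Fin N :=
  Equiv.ofBijective (place h i) (place_bijective h i)

/-- The permutation `σ ∘ᵢ τ`: it sends the block at slot `i` to the block at slot `σ i`, by `τ`
inside the block, and permutes the other inputs by `σ`. -/
noncomputable def blockPerm {n j N : ℕ} (h : N + 1 = n + j) (i : Fin n)
    (σ : Equiv.Perm (Fin n)) (τ : Equiv.Perm (Fin j)) : Equiv.Perm (Fin N) :=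
  (placeEquiv h i).symm.trans
    ((Equiv.sumCongr
      (σ.subtypeEquiv (p := fun a => a ≠ i) (q := fun a => a ≠ σ i)
        (fun a => (σ.injective.ne_iff (x := a) (y := i)).symm)) τ).trans
      (placeEquiv h (σ i)))

end OperadBlock

/-- A symmetric operad of `k`-modules with arities `1, 2, …`, given by a right action of the
symmetric groups and by partial compositions (a unit is not part of this structure, see
`SymmetricOperad.IsUnitOn`). The arity `N = n - 1 + j` of a composite is given by a proof of
`N + 1 = n + j`. Inputs are counted from `0`. -/
structure SymmetricOperad (k : Type w) [CommRing k] where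
  /-- the operations with `n` inputs -/
  Op : ℕ+ → Type x
  [addCommGroup : ∀ n, AddCommGroup (Op n)]
  [module : ∀ n, Module k (Op n)]
  /-- `act σ f` is `f · σ` -/
  act : ∀ {n : ℕ+}, Equiv.Perm (Fin n) → Op n →ₗ[k] Op n
  /-- `comp h i f g` is `f ∘ᵢ g` -/
  comp : ∀ {n j N : ℕ+}, (N : ℕ) + 1 = n + j → Fin n → Op n →ₗ[k] Op j →ₗ[k] Op N
  act_one : ∀ {n : ℕ+} (f : Op n), act 1 f = f
  act_mul : ∀ {n : ℕ+} (σ τ : Equiv.Perm (Fin n)) (f : Op n), act (σ * τ) f = act τ (act σ f)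
  /-- `(f · σ) ∘ᵢ (g · τ) = (f ∘_{σ i} g) · (σ ∘ᵢ τ)` -/
  act_comp : ∀ {n j N : ℕ+} (h : (N : ℕ) + 1 = n + j) (i : Fin n)
    (σ : Equiv.Perm (Fin n)) (τ : Equiv.Perm (Fin j)) (f : Op n) (g : Op j),
    comp h i (act σ f) (act τ g) = act (OperadBlock.blockPerm h i σ τ) (comp h (σ i) f g)
  /-- `(f ∘ᵢ g) ∘_{i + a} e = f ∘ᵢ (g ∘ₐ e)` -/
  assoc_seq : ∀ {n j l M K N : ℕ+} (hM : (M : ℕ) + 1 = n + j) (hN : (N : ℕ) + 1 = M + l)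
    (hK : (K : ℕ) + 1 = j + l) (hN' : (N : ℕ) + 1 = n + K) (i : Fin n) (a : Fin j)
    (b : Fin M) (_ : (b : ℕ) = i + a) (f : Op n) (g : Op j) (e : Op l),
    comp hN b (comp hM i f g) e = comp hN' i f (comp hK a g e)
  /-- `(f ∘ᵢ g) ∘_{a + j - 1} e = (f ∘ₐ e) ∘ᵢ g` for `i < a` -/
  assoc_par : ∀ {n j l M K N : ℕ+} (hM : (M : ℕ) + 1 = n + j) (hN : (N : ℕ) + 1 = M + l)
    (hK : (K : ℕ) + 1 = n + l) (hN' : (N : ℕ) + 1 = K + j) (i a : Fin n) (_ : i < a)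
    (b : Fin M) (_ : (b : ℕ) + 1 = a + j) (c : Fin K) (_ : (c : ℕ) = i)
    (f : Op n) (g : Op j) (e : Op l),
    comp hN b (comp hM i f g) e = comp hN' c (comp hK a f e) g

attribute [instance] SymmetricOperad.addCommGroup SymmetricOperad.module

namespace SymmetricOperad

variable {k : Type w} [CommRing k]

/-- A suboperad: a family of linear subspaces that is stable under the symmetric groups and under
all partial compositions. -/
structure IsSuboperad (P : SymmetricOperad.{w, x} k) (S : ∀ n : ℕ+, Set (P.Op n)) : Prop where
  zero_mem : ∀ n, (0 : P.Op n) ∈ S n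
  add_mem : ∀ n, ∀ f ∈ S n, ∀ g ∈ S n, f + g ∈ S n
  smul_mem : ∀ n, ∀ (c : k), ∀ f ∈ S n, c • f ∈ S n
  act_mem : ∀ (n : ℕ+) (σ : Equiv.Perm (Fin n)), ∀ f ∈ S n, P.act σ f ∈ S n
  comp_mem : ∀ (n j N : ℕ+) (h : (N : ℕ) + 1 = n + j) (i : Fin n), ∀ f ∈ S n, ∀ g ∈ S j,
    P.comp h i f g ∈ S N

/-- `e` is an operadic unit for the family `S`: it lies in `S 1`, and `e ∘ f = f` and `f ∘ᵢ e = f`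
for all `f` in the family. -/
structure IsUnitOn (P : SymmetricOperad.{w, x} k) (S : ∀ n : ℕ+, Set (P.Op n)) (e : P.Op 1) :
    Prop where
  mem : e ∈ S 1
  unit_comp : ∀ (n : ℕ+) (h : (n : ℕ) + 1 = (1 : ℕ+) + n) (i : Fin (1 : ℕ+)), ∀ f ∈ S n,
    P.comp h i e f = f
  comp_unit : ∀ (n : ℕ+) (h : (n : ℕ) + 1 = n + (1 : ℕ+)) (i : Fin n), ∀ f ∈ S n,
    P.comp h i f e = f

end SymmetricOperad

/-! ## Colored graphs -/

/-- A finite graph given by vertices and flags (half-edges), with colors in `VCL` for the vertices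
and in `FCL` for the flags. The flag `f` is attached to the vertex `att f` and joined with the flag
`join f`; it is an external line if `join f = f`, and `{f, join f}` is an inner edge otherwise. -/
structure ColoredGraph (VCL : Type u) (FCL : Type v) where
  Vert : Type
  Flag : Type
  [finite_vert : Finite Vert]
  [finite_flag : Finite Flag]
  att : Flag → Vert
  join : Flag → Flag
  join_join : ∀ f, join (join f) = f
  vcol : Vert → VCL
  fcol : Flag → FCL

attribute [instance] ColoredGraph.finite_vert ColoredGraph.finite_flag

namespace ColoredGraph

variable {VCL : Type u} {FCL : Type v}

/-- A tadpole is an inner edge attached to one and the same vertex. -/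
def HasTadpole (G : ColoredGraph VCL FCL) : Prop :=
  ∃ f, f ≠ G.join f ∧ G.att f = G.att (G.join f)

/-- All pairs of colors at the inner edges are in `Adm`. -/
def IsAdmissible (Adm : Set (FCL × FCL)) (G : ColoredGraph VCL FCL) : Prop :=
  ∀ f, f ≠ G.join f → (G.fcol f, G.fcol (G.join f)) ∈ Adm

open Classical in
/-- The graph `G_J` of a subgraph, that is of a set `J` of vertices. -/
noncomputable def subgraph (G : ColoredGraph VCL FCL) (J : Set G.Vert) :
    ColoredGraph VCL FCL where
  Vert := {p : G.Vert // p ∈ J}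
  Flag := {f : G.Flag // G.att f ∈ J}
  att f := ⟨G.att f.1, f.2⟩
  join f := if h : G.att (G.join f.1) ∈ J then ⟨G.join f.1, h⟩ else f
  join_join f := by
    by_cases h : G.att (G.join f.1) ∈ J
    · simp [h, G.join_join, f.2]
    · simp [h]
  vcol p := G.vcol p.1
  fcol f := G.fcol f.1

open Classical in
/-- The contracted graph `G/(J,L)`: the vertices of `J` are shrunk to a single vertex `v_J`, which
is `none` here, with the color `L`, and the inner edges of `G_J` are removed. -/
noncomputable def contract (G : ColoredGraph VCL FCL) (J : Set G.Vert) (L : VCL) :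
    ColoredGraph VCL FCL where
  Vert := Option {p : G.Vert // p ∉ J}
  Flag := {f : G.Flag // G.att f ∈ J ∧ G.att (G.join f) ∈ J → f = G.join f}
  att f := if h : G.att f.1 ∈ J then none else some ⟨G.att f.1, h⟩
  join f := ⟨G.join f.1, fun h => by
    rw [G.join_join] at h ⊢
    exact (f.2 ⟨h.2, h.1⟩).symm⟩
  join_join f := Subtype.ext (G.join_join f.1)
  vcol p := p.elim L (fun q => G.vcol q.1)
  fcol f := G.fcol f.1

end ColoredGraph

/-- An enumerated colored graph with `n` vertices; the numbers are `0, …, n - 1`. -/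
structure EnumGraph (VCL : Type u) (FCL : Type v) (n : ℕ) extends ColoredGraph VCL FCL where
  enu : Vert ≃ Fin n

/-- The unique bijection of a finite set `W` with `m` elements with `Fin m` that is increasing for
the order on `W` induced by an injective map `r : W → ℕ`. -/
noncomputable def monoEnum {W : Type} [Finite W] {m : ℕ} (r : W → ℕ) (hr : Function.Injective r)
    (hm : Nat.card W = m) : W ≃ Fin m :=
  letI := LinearOrder.lift' r hr
  letI := Fintype.ofFinite W
  (Fintype.orderIsoFinOfCardEq W (Nat.card_eq_fintype_card.symm.trans hm)).symm.toEquiv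

theorem monoEnum_lt {W : Type} [Finite W] {m : ℕ} (r : W → ℕ) (hr : Function.Injective r)
    (hm : Nat.card W = m) {a b : W} (h : r a < r b) : monoEnum r hr hm a < monoEnum r hr hm b := by
  let _ := LinearOrder.lift' r hr
  let _ := Fintype.ofFinite W
  exact (Fintype.orderIsoFinOfCardEq W
    (Nat.card_eq_fintype_card.symm.trans hm)).symm.strictMono (a := a) (b := b) h

theorem monoEnum_eq {W : Type} [Finite W] {m : ℕ} (r : W → ℕ) (hr : Function.Injective r)
    (hm : Nat.card W = m) (e : W ≃ Fin m) (he : ∀ a b, r a < r b → e a < e b) :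
    monoEnum r hr hm = e := by
  have hmono : StrictMono (fun i => e ((monoEnum r hr hm).symm i)) := by
    intro a b hab
    apply he
    by_contra hcon
    rcases (not_lt.mp hcon).lt_or_eq with h | h
    · have := monoEnum_lt r hr hm h
      simp only [Equiv.apply_symm_apply] at this
      exact absurd hab this.asymm
    · have := hr h
      simp only [EmbeddingLike.apply_eq_iff_eq] at this
      exact absurd this hab.ne'
  have hid : ∀ i, e ((monoEnum r hr hm).symm i) = i := by
    intro i
    have := Subsingleton.elim
      (StrictMono.orderIsoOfSurjective _ hmono
        (fun y => ⟨monoEnum r hr hm (e.symm y), by simp⟩)) (OrderIso.refl (Fin m))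
    exact congrArg (fun o : Fin m ≃o Fin m => o i) this
  ext p
  have := hid (monoEnum r hr hm p)
  rw [Equiv.symm_apply_apply] at this
  rw [this]

namespace EnumGraph

variable {VCL : Type u} {FCL : Type v}

/-- Isomorphism of enumerated colored graphs. -/
def Isomorphic {n : ℕ} (G H : EnumGraph VCL FCL n) : Prop :=
  ∃ (jv : G.Vert ≃ H.Vert) (jf : G.Flag ≃ H.Flag),
    (∀ f, jv (G.att f) = H.att (jf f)) ∧ (∀ f, jf (G.join f) = H.join (jf f)) ∧
    (∀ p, G.vcol p = H.vcol (jv p)) ∧ (∀ f, G.fcol f = H.fcol (jf f)) ∧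
    (∀ p, G.enu p = H.enu (jv p))

theorem isomorphic_equivalence (n : ℕ) : Equivalence (Isomorphic (VCL := VCL) (FCL := FCL)
    (n := n)) where
  refl G := ⟨Equiv.refl _, Equiv.refl _, by simp⟩
  symm := by
    rintro G H ⟨jv, jf, h1, h2, h3, h4, h5⟩
    refine ⟨jv.symm, jf.symm, fun f => ?_, fun f => ?_, fun p => ?_, fun f => ?_, fun p => ?_⟩
    · rw [Equiv.symm_apply_eq, h1, Equiv.apply_symm_apply]
    · rw [Equiv.symm_apply_eq, h2, Equiv.apply_symm_apply]
    · rw [h3, Equiv.apply_symm_apply]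
    · rw [h4, Equiv.apply_symm_apply]
    · rw [h5, Equiv.apply_symm_apply]
  trans := by
    rintro G H K ⟨jv, jf, h1, h2, h3, h4, h5⟩ ⟨iv, jg, g1, g2, g3, g4, g5⟩
    refine ⟨jv.trans iv, jf.trans jg, fun f => ?_, fun f => ?_, fun p => ?_, fun f => ?_,
      fun p => ?_⟩ <;> simp [*]

instance setoid (VCL : Type u) (FCL : Type v) (n : ℕ) : Setoid (EnumGraph VCL FCL n) :=
  ⟨Isomorphic, isomorphic_equivalence n⟩

/-- Renumbering the vertices: the vertex with number `a` gets the number `σ a`. -/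
def relabel {n : ℕ} (σ : Equiv.Perm (Fin n)) (G : EnumGraph VCL FCL n) : EnumGraph VCL FCL n where
  toColoredGraph := G.toColoredGraph
  enu := G.enu.trans σ

/-- The graph of a subgraph `J` with `m` vertices, with the induced increasing enumeration. -/
noncomputable def subgraph {n m : ℕ} (G : EnumGraph VCL FCL n) (J : Set G.Vert)
    (hm : Nat.card J = m) : EnumGraph VCL FCL m where
  toColoredGraph := G.toColoredGraph.subgraph J
  enu := monoEnum (W := {p : G.Vert // p ∈ J}) (fun p => (G.enu p.1 : ℕ))
    (fun _ _ h => Subtype.ext (G.enu.injective (Fin.ext h))) hm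

/-- The positions in the old enumeration by which the vertices of `G/(J,L)` are ordered: the vertex
`v_J` stands at the place of the least number in `J`. -/
noncomputable def contractRank {n : ℕ} (G : EnumGraph VCL FCL n) (J : Set G.Vert) :
    Option {p : G.Vert // p ∉ J} → ℕ
  | none => sInf ((fun p => (G.enu p : ℕ)) '' J)
  | some p => G.enu p.1

theorem contractRank_injective {n : ℕ} (G : EnumGraph VCL FCL n) (J : Set G.Vert)
    (hJ : J.Nonempty) : Function.Injective (G.contractRank J) := by
  obtain ⟨q, hq, hq'⟩ := Nat.sInf_mem (hJ.image (fun p => (G.enu p : ℕ)))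
  rintro (_ | ⟨a, ha⟩) (_ | ⟨b, hb⟩) h
  · rfl
  · simp only [contractRank] at h
    rw [← hq'] at h
    exact absurd (G.enu.injective (Fin.ext h) ▸ hq) hb
  · simp only [contractRank] at h
    rw [← hq'] at h
    exact absurd (G.enu.injective (Fin.ext h) ▸ hq) ha
  · simp only [contractRank] at h
    have := G.enu.injective (Fin.ext h)
    subst this; rfl

/-- The contracted graph `G/(J,L)` with its `m` vertices, with the induced increasing
enumeration. -/
noncomputable def contract {n m : ℕ} (G : EnumGraph VCL FCL n) (J : Set G.Vert)
    (hJ : J.Nonempty) (hm : Nat.card (Option {p : G.Vert // p ∉ J}) = m) (L : VCL) :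
    EnumGraph VCL FCL m where
  toColoredGraph := G.toColoredGraph.contract J L
  enu := monoEnum (W := Option {p : G.Vert // p ∉ J}) (G.contractRank J)
    (G.contractRank_injective J hJ) hm

/-- The set of vertices with numbers `i, …, i + j - 1`. -/
def block {N : ℕ} (G : EnumGraph VCL FCL N) (i j : ℕ) : Set G.Vert :=
  {p | i ≤ (G.enu p : ℕ) ∧ (G.enu p : ℕ) < i + j}

theorem card_block {n j N : ℕ} (h : N + 1 = n + j) (i : Fin n) (G : EnumGraph VCL FCL N) :
    Nat.card (G.block i j) = j := by
  have e : G.block i j ≃ Fin j :=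
    { toFun := fun p => ⟨(G.enu p.1 : ℕ) - i, by have := p.2.1; have := p.2.2; omega⟩
      invFun := fun a => ⟨G.enu.symm ⟨i + a, by omega⟩, by simp [block]⟩
      left_inv := fun p => by
        apply Subtype.ext
        simp only
        rw [Equiv.symm_apply_eq]
        apply Fin.ext
        have := p.2.1
        grind
      right_inv := fun a => by
        apply Fin.ext
        simp }
  rw [Nat.card_congr e, Nat.card_fin]

theorem card_contract_block {n j N : ℕ} (h : N + 1 = n + j) (i : Fin n)
    (G : EnumGraph VCL FCL N) : Nat.card (Option {p : G.Vert // p ∉ G.block i j}) = n := by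
  have h1 := card_block h i G
  have h2 : Nat.card G.Vert = N := by rw [Nat.card_congr G.enu, Nat.card_fin]
  have h3 : Nat.card {p : G.Vert // p ∉ G.block i j} + Nat.card (G.block i j)
      = Nat.card G.Vert := by
    classical
    rw [← Nat.card_congr (Equiv.sumCompl (fun p => p ∈ G.block i j)), Nat.card_sum, add_comm]
  rw [Finite.card_option]
  omega

theorem block_nonempty {n j N : ℕ} (h : N + 1 = n + j) (hj : 0 < j) (i : Fin n)
    (G : EnumGraph VCL FCL N) : (G.block i j).Nonempty :=
  ⟨G.enu.symm ⟨i, by omega⟩, by simp [block, hj]⟩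

/-- The graph of the subgraph on the vertices with numbers `i, …, i + j - 1`. -/
noncomputable def sub {n j N : ℕ} (h : N + 1 = n + j) (i : Fin n) (G : EnumGraph VCL FCL N) :
    EnumGraph VCL FCL j :=
  G.subgraph (G.block i j) (card_block h i G)

/-- The contraction of the subgraph on the vertices with numbers `i, …, i + j - 1`. -/
noncomputable def contr {n j N : ℕ} (h : N + 1 = n + j) (hj : 0 < j) (i : Fin n) (L : VCL)
    (G : EnumGraph VCL FCL N) : EnumGraph VCL FCL n :=
  G.contract (G.block i j) (block_nonempty h hj i G) (card_contract_block h i G) L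

/-! ### Isomorphisms used to pass to classes of graphs and to check the operad laws -/

/-- The number of the vertex to which a flag is attached. -/
def pos {n : ℕ} (G : EnumGraph VCL FCL n) (f : G.Flag) : ℕ := G.enu (G.att f)

/-- The color of the vertex with number `a`, if there is one. -/
def col {n : ℕ} (G : EnumGraph VCL FCL n) (a : ℕ) : Option VCL :=
  if h : a < n then some (G.vcol (G.enu.symm ⟨a, h⟩)) else none

theorem iso_of_embed {n : ℕ} {G H : EnumGraph VCL FCL n} {A : Type} (g : G.Flag → A)
    (h : H.Flag → A) (hg : Function.Injective g) (hh : Function.Injective h)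
    (hgh : ∀ a, ∃ b, g a = h b) (hhg : ∀ b, ∃ a, g a = h b)
    (hpos : ∀ a b, g a = h b → G.pos a = H.pos b)
    (hjoin : ∀ a b, g a = h b → g (G.join a) = h (H.join b))
    (hfcol : ∀ a b, g a = h b → G.fcol a = H.fcol b) (hcol : ∀ a, G.col a = H.col a) :
    Isomorphic G H := by
  choose s hs using hgh
  choose t ht using hhg
  refine ⟨G.enu.trans H.enu.symm, ⟨s, t, fun a => hg ?_, fun b => hh ?_⟩, fun f => ?_,
    fun f => ?_, fun p => ?_, fun f => hfcol _ _ (hs f), fun p => by simp⟩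
  · rw [ht, hs]
  · rw [← hs, ht]
  · simp only [Equiv.trans_apply, Equiv.coe_fn_mk]
    rw [Equiv.symm_apply_eq]
    exact Fin.ext (hpos _ _ (hs f))
  · apply hh
    simp only [Equiv.coe_fn_mk]
    rw [← hs, hjoin _ _ (hs f)]
  · have := hcol (G.enu p)
    simpa [col] using this

theorem pos_of_iso {n : ℕ} {G H : EnumGraph VCL FCL n} (e : Isomorphic G H) :
    ∃ jf : G.Flag ≃ H.Flag, (∀ f, H.pos (jf f) = G.pos f) ∧
      (∀ f, jf (G.join f) = H.join (jf f)) ∧ (∀ f, H.fcol (jf f) = G.fcol f) ∧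
      (∀ a, G.col a = H.col a) := by
  obtain ⟨jv, jf, h1, h2, h3, h4, h5⟩ := e
  refine ⟨jf, fun f => ?_, h2, fun f => (h4 f).symm, fun a => ?_⟩
  · simp only [pos]
    rw [← h1, ← h5]
  · simp only [col]
    split_ifs with h
    · rw [h3]
      congr 2
      rw [Equiv.eq_symm_apply, ← h5, Equiv.apply_symm_apply]
    · rfl

theorem mem_block {N : ℕ} (G : EnumGraph VCL FCL N) (i j : ℕ) (p : G.Vert) :
    p ∈ G.block i j ↔ i ≤ (G.enu p : ℕ) ∧ (G.enu p : ℕ) < i + j := Iff.rfl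

theorem sub_enu {n j N : ℕ} (h : N + 1 = n + j) (i : Fin n) (G : EnumGraph VCL FCL N)
    (p : (G.sub h i).Vert) : ((G.sub h i).enu p : ℕ) = G.enu p.1 - i := by
  let r : {p : G.Vert // p ∈ G.block i j} → ℕ := fun p => (G.enu p.1 : ℕ)
  have hr : Function.Injective r := fun _ _ h => Subtype.ext (G.enu.injective (Fin.ext h))
  let φ : {p : G.Vert // p ∈ G.block i j} → Fin j :=
    fun p => ⟨(G.enu p.1 : ℕ) - i, by have := p.2.1; have := p.2.2; omega⟩
  have hφ : Function.Bijective φ := by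
    have := Fintype.ofFinite {p : G.Vert // p ∈ G.block i j}
    rw [Fintype.bijective_iff_injective_and_card]
    refine ⟨fun a b hab => hr ?_, ?_⟩
    · have h1 := a.2.1
      have h2 := b.2.1
      have h3 := congrArg Fin.val hab
      simp only [φ] at h3
      simp only [r]
      omega
    · rw [← Nat.card_eq_fintype_card, Fintype.card_fin]
      exact card_block h i G
  have := monoEnum_eq r hr (card_block h i G) (Equiv.ofBijective φ hφ) (fun a b hab => by
    have h1 := a.2.1
    have h2 := b.2.1
    simp only [r] at hab
    simp only [Equiv.ofBijective_apply, φ, Fin.mk_lt_mk]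
    omega)
  exact congrArg (fun e : {p : G.Vert // p ∈ G.block i j} ≃ Fin j => (e p : ℕ)) this

/-- What becomes of the number `p` when the numbers `i, …, i + j - 1` are replaced by `i`. -/
def collapse (i j p : ℕ) : ℕ := if p < i then p else if p < i + j then i else p + 1 - j

theorem contractRank_block_none {n j N : ℕ} (h : N + 1 = n + j) (hj : 0 < j) (i : Fin n)
    (G : EnumGraph VCL FCL N) : G.contractRank (G.block i j) none = i := by
  simp only [contractRank]
  have hN : (i : ℕ) < N := by omega
  apply le_antisymm
  · exact Nat.sInf_le ⟨G.enu.symm ⟨i, hN⟩, by simp [block, hj], by simp⟩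
  · obtain ⟨q, hq, hq'⟩ :=
      Nat.sInf_mem ((block_nonempty h hj i G).image (fun p => (G.enu p : ℕ)))
    rw [← hq']
    exact hq.1

theorem contr_enu {n j N : ℕ} (h : N + 1 = n + j) (hj : 0 < j) (i : Fin n) (L : VCL)
    (G : EnumGraph VCL FCL N) (p : (G.contr h hj i L).Vert) :
    ((G.contr h hj i L).enu p : ℕ) = collapse i j (G.contractRank (G.block i j) p) := by
  have hr := G.contractRank_injective (G.block i j) (block_nonempty h hj i G)
  have hn := contractRank_block_none h hj i G
  have hs : ∀ q : {p : G.Vert // p ∉ G.block i j},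
      G.contractRank (G.block i j) (some q) = G.enu q.1 := fun q => rfl
  have hq : ∀ q : {p : G.Vert // p ∉ G.block i j},
      (G.enu q.1 : ℕ) < i ∨ i + j ≤ (G.enu q.1 : ℕ) := fun q => by
    have := q.2
    rw [mem_block] at this
    omega
  let φ : Option {p : G.Vert // p ∉ G.block i j} → Fin n :=
    fun p => ⟨collapse i j (G.contractRank (G.block i j) p), by
      rcases p with _ | q
      · rw [hn, collapse]; split_ifs <;> omega
      · rw [hs, collapse]
        have := hq q
        have := (G.enu q.1).2
        split_ifs <;> omega⟩
  have hlt : ∀ a b, G.contractRank (G.block i j) a < G.contractRank (G.block i j) b →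
      φ a < φ b := by
    intro a b hab
    simp only [φ, Fin.mk_lt_mk, collapse]
    rcases a with _ | a <;> rcases b with _ | b
    · omega
    · rw [hn, hs] at *
      have := hq b
      split_ifs <;> omega
    · rw [hn, hs] at *
      have := hq a
      split_ifs <;> omega
    · rw [hs, hs] at *
      have := hq a
      have := hq b
      split_ifs <;> omega
  have hφ : Function.Bijective φ := by
    have := Fintype.ofFinite (Option {p : G.Vert // p ∉ G.block i j})
    rw [Fintype.bijective_iff_injective_and_card]
    refine ⟨fun a b hab => hr ?_, ?_⟩
    · rcases lt_trichotomy (G.contractRank (G.block i j) a) (G.contractRank (G.block i j) b)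
        with hc | hc | hc
      · exact absurd hab (hlt _ _ hc).ne
      · exact hc
      · exact absurd hab (hlt _ _ hc).ne'
    · rw [← Nat.card_eq_fintype_card, Fintype.card_fin]
      exact card_contract_block h i G
  have := monoEnum_eq (G.contractRank (G.block i j)) hr (card_contract_block h i G)
    (Equiv.ofBijective φ hφ) hlt
  exact congrArg (fun e : Option {p : G.Vert // p ∉ G.block i j} ≃ Fin n => (e p : ℕ)) this

/-- The inclusion of flags. -/
def subFlag {n j N : ℕ} (h : N + 1 = n + j) (i : Fin n) (G : EnumGraph VCL FCL N)
    (f : (G.sub h i).Flag) : G.Flag := Subtype.val (p := fun f => G.att f ∈ G.block i j) f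

theorem subFlag_injective {n j N : ℕ} (h : N + 1 = n + j) (i : Fin n) (G : EnumGraph VCL FCL N) :
    Function.Injective (G.subFlag h i) := Subtype.val_injective

theorem exists_subFlag {n j N : ℕ} (h : N + 1 = n + j) (i : Fin n) (G : EnumGraph VCL FCL N)
    (f : G.Flag) : (∃ a, G.subFlag h i a = f) ↔ i ≤ G.pos f ∧ G.pos f < i + j :=
  ⟨fun ⟨a, ha⟩ => ha ▸ a.2, fun hf => ⟨⟨f, hf⟩, rfl⟩⟩

theorem sub_flag {n j N : ℕ} (h : N + 1 = n + j) (i : Fin n) (G : EnumGraph VCL FCL N)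
    (f : (G.sub h i).Flag) : i ≤ G.pos (G.subFlag h i f) ∧ G.pos (G.subFlag h i f) < i + j :=
  f.2

theorem sub_pos {n j N : ℕ} (h : N + 1 = n + j) (i : Fin n) (G : EnumGraph VCL FCL N)
    (f : (G.sub h i).Flag) : (G.sub h i).pos f = G.pos (G.subFlag h i f) - i :=
  sub_enu h i G _

theorem sub_fcol {n j N : ℕ} (h : N + 1 = n + j) (i : Fin n) (G : EnumGraph VCL FCL N)
    (f : (G.sub h i).Flag) : (G.sub h i).fcol f = G.fcol (G.subFlag h i f) := rfl

theorem sub_join {n j N : ℕ} (h : N + 1 = n + j) (i : Fin n) (G : EnumGraph VCL FCL N)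
    (f : (G.sub h i).Flag) : G.subFlag h i ((G.sub h i).join f) =
      if i ≤ G.pos (G.join (G.subFlag h i f)) ∧ G.pos (G.join (G.subFlag h i f)) < i + j
      then G.join (G.subFlag h i f) else G.subFlag h i f := by
  classical
  have key : ∀ a : {f : G.Flag // G.att f ∈ G.block i j},
      ((G.toColoredGraph.subgraph (G.block i j)).join a : {f : G.Flag // G.att f ∈ G.block i j}).1
      = if G.att (G.join a.1) ∈ G.block i j then G.join a.1 else a.1 := by
    intro a
    change (if h : G.att (G.join a.1) ∈ G.block i j then
      (⟨G.join a.1, h⟩ : {f : G.Flag // G.att f ∈ G.block i j}) else a).1 = _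
    by_cases hc : G.att (G.join a.1) ∈ G.block i j
    · rw [dif_pos hc, if_pos hc]
    · rw [dif_neg hc, if_neg hc]
  refine (key f).trans ?_
  congr

/-- The inclusion of flags. -/
def contrFlag {n j N : ℕ} (h : N + 1 = n + j) (hj : 0 < j) (i : Fin n) (L : VCL)
    (G : EnumGraph VCL FCL N) (f : (G.contr h hj i L).Flag) : G.Flag :=
  Subtype.val
    (p := fun f => G.att f ∈ G.block i j ∧ G.att (G.join f) ∈ G.block i j → f = G.join f) f

theorem contrFlag_injective {n j N : ℕ} (h : N + 1 = n + j) (hj : 0 < j) (i : Fin n) (L : VCL)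
    (G : EnumGraph VCL FCL N) : Function.Injective (G.contrFlag h hj i L) :=
  Subtype.val_injective

theorem exists_contrFlag {n j N : ℕ} (h : N + 1 = n + j) (hj : 0 < j) (i : Fin n) (L : VCL)
    (G : EnumGraph VCL FCL N) (f : G.Flag) : (∃ a, G.contrFlag h hj i L a = f) ↔
      ((i ≤ G.pos f ∧ G.pos f < i + j) ∧ (i ≤ G.pos (G.join f) ∧ G.pos (G.join f) < i + j) →
        f = G.join f) :=
  ⟨fun ⟨a, ha⟩ => ha ▸ a.2, fun hf => ⟨⟨f, hf⟩, rfl⟩⟩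

theorem contr_flag {n j N : ℕ} (h : N + 1 = n + j) (hj : 0 < j) (i : Fin n) (L : VCL)
    (G : EnumGraph VCL FCL N) (f : (G.contr h hj i L).Flag) :
    (i ≤ G.pos (G.contrFlag h hj i L f) ∧ G.pos (G.contrFlag h hj i L f) < i + j) ∧
      (i ≤ G.pos (G.join (G.contrFlag h hj i L f)) ∧
        G.pos (G.join (G.contrFlag h hj i L f)) < i + j) →
      G.contrFlag h hj i L f = G.join (G.contrFlag h hj i L f) := f.2

theorem contr_join {n j N : ℕ} (h : N + 1 = n + j) (hj : 0 < j) (i : Fin n) (L : VCL)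
    (G : EnumGraph VCL FCL N) (f : (G.contr h hj i L).Flag) :
    G.contrFlag h hj i L ((G.contr h hj i L).join f) = G.join (G.contrFlag h hj i L f) := rfl

theorem contr_fcol {n j N : ℕ} (h : N + 1 = n + j) (hj : 0 < j) (i : Fin n) (L : VCL)
    (G : EnumGraph VCL FCL N) (f : (G.contr h hj i L).Flag) :
    (G.contr h hj i L).fcol f = G.fcol (G.contrFlag h hj i L f) := rfl

theorem contr_pos {n j N : ℕ} (h : N + 1 = n + j) (hj : 0 < j) (i : Fin n) (L : VCL)
    (G : EnumGraph VCL FCL N) (f : (G.contr h hj i L).Flag) :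
    (G.contr h hj i L).pos f = collapse i j (G.pos (G.contrFlag h hj i L f)) := by
  classical
  rw [pos, contr_enu]
  have key : ∀ a : {f : G.Flag //
      G.att f ∈ G.block i j ∧ G.att (G.join f) ∈ G.block i j → f = G.join f},
      collapse i j (G.contractRank (G.block i j)
        ((G.toColoredGraph.contract (G.block i j) L).att a)) = collapse i j (G.pos a.1) := by
    intro a
    change collapse i j (G.contractRank (G.block i j) (if h : G.att a.1 ∈ G.block i j then none
      else some (⟨G.att a.1, h⟩ : {p : G.Vert // p ∉ G.block i j}))) = _
    by_cases hc : G.att a.1 ∈ G.block i j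
    · rw [dif_pos hc, contractRank_block_none h hj]
      rw [mem_block] at hc
      have e1 : collapse i j i = i := by simp [collapse, hj]
      have e2 : collapse i j (G.pos a.1) = i := by
        rw [collapse, if_neg (by rw [pos]; omega), if_pos (show G.pos a.1 < i + j from hc.2)]
      rw [e1, e2]
    · rw [dif_neg hc]
      rfl
  exact key f

theorem col_eq {n : ℕ} (G : EnumGraph VCL FCL n) (p : G.Vert) (a : ℕ) (h : a = G.enu p) :
    G.col a = some (G.vcol p) := by
  subst h
  simp [col]

theorem col_none {n : ℕ} (G : EnumGraph VCL FCL n) (a : ℕ) (h : n ≤ a) : G.col a = none := by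
  simp [col, h]

theorem sub_col {n j N : ℕ} (h : N + 1 = n + j) (i : Fin n) (G : EnumGraph VCL FCL N) (a : ℕ) :
    (G.sub h i).col a = if a < j then G.col (i + a) else none := by
  split_ifs with ha
  · obtain ⟨p, hp⟩ := (G.sub h i).enu.surjective ⟨a, ha⟩
    have h1 : a = (G.sub h i).enu p := by rw [hp]
    rw [col_eq _ p a h1]
    have h2 := sub_enu h i G p
    have h3 : (i : ℕ) ≤ G.enu p.1 := p.2.1
    rw [col_eq G p.1 (i + a) (by omega)]
    rfl
  · exact col_none _ _ (by omega)

theorem contr_col {n j N : ℕ} (h : N + 1 = n + j) (hj : 0 < j) (i : Fin n) (L : VCL)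
    (G : EnumGraph VCL FCL N) (a : ℕ) : (G.contr h hj i L).col a =
      if a < i then G.col a else if a = i then some L else G.col (a + j - 1) := by
  by_cases ha : a < n
  · obtain ⟨p, hp⟩ := (G.contr h hj i L).enu.surjective ⟨a, ha⟩
    have h1 : a = (G.contr h hj i L).enu p := by rw [hp]
    rw [col_eq _ p a h1]
    rw [contr_enu] at h1
    rcases p with _ | p
    · rw [contractRank_block_none h hj, collapse] at h1
      rw [if_neg (by split_ifs at h1 <;> omega), if_pos (by split_ifs at h1 <;> omega)]
      rfl
    · have hq := p.2
      rw [mem_block] at hq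
      have hs : G.contractRank (G.block i j) (some p) = G.enu p.1 := rfl
      rw [hs, collapse] at h1
      have hc : (G.contr h hj i L).vcol (some p) = G.vcol p.1 := rfl
      rw [hc]
      by_cases hlt : (G.enu p.1 : ℕ) < i
      · rw [if_pos hlt] at h1
        rw [if_pos (by omega), col_eq G p.1 a h1]
      · rw [if_neg hlt, if_neg (by omega)] at h1
        rw [if_neg (by omega), if_neg (by omega), col_eq G p.1 _ (by omega)]
  · rw [col_none _ _ (by omega), if_neg (by omega), if_neg (by omega), col_none _ _ (by omega)]

theorem relabel_pos {n : ℕ} (σ : Equiv.Perm (Fin n)) (G : EnumGraph VCL FCL n) (f : G.Flag) :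
    (G.relabel σ).pos f = σ (G.enu (G.att f)) := rfl

theorem relabel_col {n : ℕ} (σ : Equiv.Perm (Fin n)) (G : EnumGraph VCL FCL n) (a : Fin n) :
    (G.relabel σ).col (σ a) = G.col a := by
  rw [col_eq (G.relabel σ) (G.enu.symm a) _ (by
      have : (G.relabel σ).enu (G.enu.symm a) = σ (G.enu (G.enu.symm a)) := rfl
      rw [this, Equiv.apply_symm_apply]),
    col_eq G (G.enu.symm a) _ (by simp)]
  rfl

theorem relabel_iso {n : ℕ} (σ : Equiv.Perm (Fin n)) {G H : EnumGraph VCL FCL n}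
    (e : Isomorphic G H) : Isomorphic (G.relabel σ) (H.relabel σ) := by
  obtain ⟨jv, jf, h1, h2, h3, h4, h5⟩ := e
  exact ⟨jv, jf, h1, h2, h3, h4, fun p => congrArg σ (h5 p)⟩

theorem sub_iso {n j N : ℕ} (h : N + 1 = n + j) (i : Fin n) {G H : EnumGraph VCL FCL N}
    (e : Isomorphic G H) : Isomorphic (G.sub h i) (H.sub h i) := by
  obtain ⟨jf, h1, h2, h3, h4⟩ := pos_of_iso e
  refine iso_of_embed (fun a => jf (G.subFlag h i a)) (H.subFlag h i)
    (jf.injective.comp (subFlag_injective h i G)) (subFlag_injective h i H) ?_ ?_ ?_ ?_ ?_ ?_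
  · intro a
    simp only [eq_comm (a := jf _)]
    rw [exists_subFlag, h1]
    exact sub_flag h i G a
  · intro b
    have hb := sub_flag h i H b
    obtain ⟨c, hc⟩ := jf.surjective (H.subFlag h i b)
    rw [← hc, h1, ← exists_subFlag h] at hb
    obtain ⟨a, ha⟩ := hb
    exact ⟨a, by rw [ha, hc]⟩
  · intro a b hab
    rw [sub_pos, sub_pos, ← hab, h1]
  · intro a b hab
    rw [sub_join, sub_join, ← hab, ← h2, h1]
    split_ifs <;> rfl
  · intro a b hab
    rw [sub_fcol, sub_fcol, ← hab, h3]
  · intro a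
    rw [sub_col, sub_col, h4]

theorem contr_iso {n j N : ℕ} (h : N + 1 = n + j) (hj : 0 < j) (i : Fin n) (L : VCL)
    {G H : EnumGraph VCL FCL N} (e : Isomorphic G H) :
    Isomorphic (G.contr h hj i L) (H.contr h hj i L) := by
  obtain ⟨jf, h1, h2, h3, h4⟩ := pos_of_iso e
  refine iso_of_embed (fun a => jf (G.contrFlag h hj i L a)) (H.contrFlag h hj i L)
    (jf.injective.comp (contrFlag_injective h hj i L G)) (contrFlag_injective h hj i L H)
    ?_ ?_ ?_ ?_ ?_ ?_
  · intro a
    simp only [eq_comm (a := jf _)]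
    rw [exists_contrFlag, ← h2, h1, h1, EmbeddingLike.apply_eq_iff_eq]
    exact contr_flag h hj i L G a
  · intro b
    have hb := contr_flag h hj i L H b
    obtain ⟨c, hc⟩ := jf.surjective (H.contrFlag h hj i L b)
    rw [← hc, ← h2, h1, h1, EmbeddingLike.apply_eq_iff_eq,
      ← exists_contrFlag h hj i L] at hb
    obtain ⟨a, ha⟩ := hb
    exact ⟨a, by rw [ha, hc]⟩
  · intro a b hab
    rw [contr_pos, contr_pos, ← hab, h1]
  · intro a b hab
    rw [contr_join, contr_join, ← hab, ← h2]
  · intro a b hab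
    rw [contr_fcol, contr_fcol, ← hab, h3]
  · intro a
    rw [contr_col, contr_col, h4, h4]

theorem iso_of_range {n : ℕ} {G H : EnumGraph VCL FCL n} {A : Type} (g : G.Flag → A)
    (h : H.Flag → A) (hg : Function.Injective g) (hh : Function.Injective h)
    (hr : ∀ f, (∃ a, g a = f) ↔ (∃ b, h b = f))
    (hpos : ∀ a b, g a = h b → G.pos a = H.pos b)
    (hjoin : ∀ a b, g a = h b → g (G.join a) = h (H.join b))
    (hfcol : ∀ a b, g a = h b → G.fcol a = H.fcol b) (hcol : ∀ a, G.col a = H.col a) :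
    Isomorphic G H :=
  iso_of_embed g h hg hh
    (fun a => (((hr (g a)).1 ⟨a, rfl⟩).imp fun _ e => e.symm))
    (fun b => ((hr (h b)).2 ⟨b, rfl⟩)) hpos hjoin hfcol hcol

section Nested

variable {n j N n' j' : ℕ} (h : N + 1 = n + j) (i : Fin n)

theorem exists_sub_sub (h' : j + 1 = n' + j') (i' : Fin n') (G : EnumGraph VCL FCL N)
    (f : G.Flag) : (∃ a, G.subFlag h i ((G.sub h i).subFlag h' i' a) = f) ↔
      (i ≤ G.pos f ∧ G.pos f < i + j) ∧ (i' ≤ G.pos f - i ∧ G.pos f - i < i' + j') := by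
  rw [← exists_subFlag h]
  constructor
  · rintro ⟨a, rfl⟩
    refine ⟨⟨_, rfl⟩, ?_⟩
    rw [← sub_pos]
    exact sub_flag h' i' _ a
  · rintro ⟨⟨c, rfl⟩, hc⟩
    rw [← sub_pos, ← exists_subFlag h'] at hc
    obtain ⟨a, rfl⟩ := hc
    exact ⟨a, rfl⟩

theorem exists_contr_sub (hj : 0 < j) (L : VCL) (h' : n + 1 = n' + j') (i' : Fin n')
    (G : EnumGraph VCL FCL N) (f : G.Flag) :
    (∃ a, G.contrFlag h hj i L ((G.contr h hj i L).subFlag h' i' a) = f) ↔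
      ((i ≤ G.pos f ∧ G.pos f < i + j) ∧ (i ≤ G.pos (G.join f) ∧ G.pos (G.join f) < i + j) →
        f = G.join f) ∧
      (i' ≤ collapse i j (G.pos f) ∧ collapse i j (G.pos f) < i' + j') := by
  rw [← exists_contrFlag h hj i L]
  constructor
  · rintro ⟨a, rfl⟩
    refine ⟨⟨_, rfl⟩, ?_⟩
    rw [← contr_pos]
    exact sub_flag h' i' _ a
  · rintro ⟨⟨c, rfl⟩, hc⟩
    rw [← contr_pos, ← exists_subFlag h'] at hc
    obtain ⟨a, rfl⟩ := hc
    exact ⟨a, rfl⟩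

theorem exists_contr_contr (hj : 0 < j) (L : VCL) (h' : n + 1 = n' + j') (hj' : 0 < j')
    (i' : Fin n') (M : VCL) (G : EnumGraph VCL FCL N) (f : G.Flag) :
    (∃ a, G.contrFlag h hj i L ((G.contr h hj i L).contrFlag h' hj' i' M a) = f) ↔
      ((i ≤ G.pos f ∧ G.pos f < i + j) ∧ (i ≤ G.pos (G.join f) ∧ G.pos (G.join f) < i + j) →
        f = G.join f) ∧
      ((i' ≤ collapse i j (G.pos f) ∧ collapse i j (G.pos f) < i' + j') ∧
        (i' ≤ collapse i j (G.pos (G.join f)) ∧ collapse i j (G.pos (G.join f)) < i' + j') →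
        f = G.join f) := by
  rw [← exists_contrFlag h hj i L]
  have key : ∀ c : (G.contr h hj i L).Flag, (∃ a, (G.contr h hj i L).contrFlag h' hj' i' M a = c)
      ↔ ((i' ≤ collapse i j (G.pos (G.contrFlag h hj i L c)) ∧
          collapse i j (G.pos (G.contrFlag h hj i L c)) < i' + j') ∧
        (i' ≤ collapse i j (G.pos (G.join (G.contrFlag h hj i L c))) ∧
          collapse i j (G.pos (G.join (G.contrFlag h hj i L c))) < i' + j') →
        G.contrFlag h hj i L c = G.join (G.contrFlag h hj i L c)) := by
    intro c
    rw [exists_contrFlag, ← contr_join, ← contr_pos, ← contr_pos,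
      (contrFlag_injective h hj i L G).eq_iff]
  constructor
  · rintro ⟨a, rfl⟩
    exact ⟨⟨_, rfl⟩, (key _).1 ⟨a, rfl⟩⟩
  · rintro ⟨⟨c, rfl⟩, hc⟩
    obtain ⟨a, rfl⟩ := (key _).2 hc
    exact ⟨a, rfl⟩

theorem exists_sub_contr (h' : j + 1 = n' + j') (hj' : 0 < j') (i' : Fin n') (M : VCL)
    (G : EnumGraph VCL FCL N) (f : G.Flag) :
    (∃ a, G.subFlag h i ((G.sub h i).contrFlag h' hj' i' M a) = f) ↔
      (i ≤ G.pos f ∧ G.pos f < i + j) ∧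
      ((i' ≤ G.pos f - i ∧ G.pos f - i < i' + j') ∧
        (i ≤ G.pos (G.join f) ∧ G.pos (G.join f) < i + j) ∧
        (i' ≤ G.pos (G.join f) - i ∧ G.pos (G.join f) - i < i' + j') → f = G.join f) := by
  rw [← exists_subFlag h]
  have key : ∀ c : (G.sub h i).Flag, (∃ a, (G.sub h i).contrFlag h' hj' i' M a = c)
      ↔ ((i' ≤ G.pos (G.subFlag h i c) - i ∧ G.pos (G.subFlag h i c) - i < i' + j') ∧
        (i ≤ G.pos (G.join (G.subFlag h i c)) ∧ G.pos (G.join (G.subFlag h i c)) < i + j) ∧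
        (i' ≤ G.pos (G.join (G.subFlag h i c)) - i ∧
          G.pos (G.join (G.subFlag h i c)) - i < i' + j') →
        G.subFlag h i c = G.join (G.subFlag h i c)) := by
    intro c
    rw [exists_contrFlag, sub_pos, sub_pos, ← (subFlag_injective h i G).eq_iff, sub_join]
    split_ifs with hc
    · tauto
    · tauto
  constructor
  · rintro ⟨a, rfl⟩
    exact ⟨⟨_, rfl⟩, (key _).1 ⟨a, rfl⟩⟩
  · rintro ⟨⟨c, rfl⟩, hc⟩
    obtain ⟨a, rfl⟩ := (key _).2 hc
    exact ⟨a, rfl⟩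

end Nested

section Laws

variable {n j l M K N : ℕ} (hj : 0 < j) (hl : 0 < l)

theorem sub_sub_iso (hN : N + 1 = M + l) (hK : K + 1 = j + l) (hN' : N + 1 = n + K) (i : Fin n)
    (a : Fin j) (b : Fin M) (hb : (b : ℕ) = i + a) (G : EnumGraph VCL FCL N) :
    Isomorphic (G.sub hN b) ((G.sub hN' i).sub hK a) := by
  refine iso_of_range (G.subFlag hN b)
    (fun c => G.subFlag hN' i ((G.sub hN' i).subFlag hK a c)) (subFlag_injective hN b G)
    ((subFlag_injective hN' i G).comp (subFlag_injective hK a _)) ?_ ?_ ?_ ?_ ?_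
  · intro f
    rw [exists_subFlag, exists_sub_sub]
    omega
  · intro c d hcd
    rw [sub_pos, sub_pos, sub_pos, hcd]
    omega
  · intro c d hcd
    have hd := (exists_sub_sub hN' i hK a G _).1 ⟨d, rfl⟩
    rw [sub_join, sub_join]
    rw [apply_ite (G.subFlag hN' i), sub_join, ← hcd, sub_pos, sub_join]
    rw [← hcd] at hd ⊢
    split_ifs <;> first | rfl | (exfalso; omega)
  · intro c d hcd
    rw [sub_fcol, sub_fcol, sub_fcol, hcd]
  · intro c
    rw [sub_col, sub_col, sub_col]
    split_ifs <;> first | rfl | (exfalso; omega) | (congr 1; omega)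

theorem contr_sub_iso (hM : M + 1 = n + j) (hN : N + 1 = M + l) (hK : K + 1 = j + l)
    (hN' : N + 1 = n + K) (i : Fin n) (a : Fin j) (b : Fin M) (hb : (b : ℕ) = i + a) (L : VCL)
    (G : EnumGraph VCL FCL N) :
    Isomorphic ((G.contr hN hl b L).sub hM i) ((G.sub hN' i).contr hK hl a L) := by
  refine iso_of_range (fun c => G.contrFlag hN hl b L ((G.contr hN hl b L).subFlag hM i c))
    (fun c => G.subFlag hN' i ((G.sub hN' i).contrFlag hK hl a L c))
    ((contrFlag_injective hN hl b L G).comp (subFlag_injective hM i _))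
    ((subFlag_injective hN' i G).comp (contrFlag_injective hK hl a L _)) ?_ ?_ ?_ ?_ ?_
  · intro f
    rw [exists_contr_sub, exists_sub_contr]
    simp only [collapse]
    split_ifs <;> grind
  · intro c d hcd
    have hd := (exists_sub_contr hN' i hK hl a L G _).1 ⟨d, rfl⟩
    rw [sub_pos, contr_pos, contr_pos, sub_pos, hcd]
    simp only [collapse]
    split_ifs <;> omega
  · intro c d hcd
    have hd := (exists_sub_contr hN' i hK hl a L G _).1 ⟨d, rfl⟩
    rw [sub_join, apply_ite (G.contrFlag hN hl b L), contr_join, contr_pos, contr_join, contr_join,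
      sub_join, hcd]
    simp only [collapse]
    split_ifs <;> first | rfl | (exfalso; omega)
  · intro c d hcd
    rw [sub_fcol, contr_fcol, contr_fcol, sub_fcol, hcd]
  · intro c
    rw [sub_col, contr_col, contr_col, sub_col, sub_col]
    split_ifs <;> first | rfl | (exfalso; omega) | (congr 1; omega)

theorem contr_contr_iso (hM : M + 1 = n + j) (hN : N + 1 = M + l) (hK : K + 1 = j + l)
    (hN' : N + 1 = n + K) (hK' : 0 < K) (i : Fin n) (a : Fin j) (b : Fin M)
    (hb : (b : ℕ) = i + a) (L L' : VCL) (G : EnumGraph VCL FCL N) :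
    Isomorphic ((G.contr hN hl b L).contr hM hj i L') (G.contr hN' hK' i L') := by
  refine iso_of_range
    (fun c => G.contrFlag hN hl b L ((G.contr hN hl b L).contrFlag hM hj i L' c))
    (G.contrFlag hN' hK' i L')
    ((contrFlag_injective hN hl b L G).comp (contrFlag_injective hM hj i L' _))
    (contrFlag_injective hN' hK' i L' G) ?_ ?_ ?_ ?_ ?_
  · intro f
    rw [exists_contr_contr, exists_contrFlag]
    simp only [collapse]
    split_ifs <;> grind
  · intro c d hcd
    rw [contr_pos, contr_pos, contr_pos, hcd]
    simp only [collapse]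
    split_ifs <;> omega
  · intro c d hcd
    rw [contr_join, contr_join, contr_join, hcd]
  · intro c d hcd
    rw [contr_fcol, contr_fcol, contr_fcol, hcd]
  · intro c
    rw [contr_col, contr_col, contr_col, contr_col]
    split_ifs <;> first | rfl | (exfalso; omega) | (congr 1; omega)

theorem contr_sub_left_iso (hM : M + 1 = n + j) (hN : N + 1 = M + l) (hN' : N + 1 = K + j)
    (i a : Fin n) (hia : i < a) (b : Fin M) (hb : (b : ℕ) + 1 = a + j) (c : Fin K)
    (hc : (c : ℕ) = i) (L : VCL) (G : EnumGraph VCL FCL N) :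
    Isomorphic ((G.contr hN hl b L).sub hM i) (G.sub hN' c) := by
  rw [Fin.lt_def] at hia
  refine iso_of_range (fun c => G.contrFlag hN hl b L ((G.contr hN hl b L).subFlag hM i c))
    (G.subFlag hN' c) ((contrFlag_injective hN hl b L G).comp (subFlag_injective hM i _))
    (subFlag_injective hN' c G) ?_ ?_ ?_ ?_ ?_
  · intro f
    rw [exists_contr_sub, exists_subFlag]
    simp only [collapse]
    split_ifs <;> grind
  · intro p d hcd
    have hd := sub_flag hN' c G d
    rw [sub_pos, contr_pos, sub_pos, hcd]
    simp only [collapse]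
    split_ifs <;> omega
  · intro p d hcd
    have hd := sub_flag hN' c G d
    rw [sub_join, apply_ite (G.contrFlag hN hl b L), contr_join, contr_pos, contr_join,
      sub_join, hcd]
    simp only [collapse]
    split_ifs <;> first | rfl | (exfalso; omega)
  · intro c d hcd
    rw [sub_fcol, contr_fcol, sub_fcol, hcd]
  · intro p
    rw [sub_col, contr_col, sub_col]
    split_ifs <;> first | rfl | (exfalso; omega) | (congr 1; omega)

theorem contr_sub_right_iso (hN : N + 1 = M + l) (hK : K + 1 = n + l) (hN' : N + 1 = K + j)
    (i a : Fin n) (hia : i < a) (b : Fin M) (hb : (b : ℕ) + 1 = a + j) (c : Fin K)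
    (hc : (c : ℕ) = i) (L : VCL) (G : EnumGraph VCL FCL N) :
    Isomorphic (G.sub hN b) ((G.contr hN' hj c L).sub hK a) := by
  rw [Fin.lt_def] at hia
  refine iso_of_range (G.subFlag hN b)
    (fun d => G.contrFlag hN' hj c L ((G.contr hN' hj c L).subFlag hK a d))
    (subFlag_injective hN b G)
    ((contrFlag_injective hN' hj c L G).comp (subFlag_injective hK a _)) ?_ ?_ ?_ ?_ ?_
  · intro f
    rw [exists_contr_sub, exists_subFlag]
    simp only [collapse]
    split_ifs <;> grind
  · intro d p hcd
    have hd := sub_flag hN b G d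
    rw [sub_pos, sub_pos, contr_pos, ← hcd]
    simp only [collapse]
    split_ifs <;> omega
  · intro d p hcd
    have hd := sub_flag hN b G d
    rw [sub_join, sub_join, apply_ite (G.contrFlag hN' hj c L), contr_join, contr_pos, contr_join,
      ← hcd]
    simp only [collapse]
    split_ifs <;> first | rfl | (exfalso; omega)
  · intro c d hcd
    rw [sub_fcol, sub_fcol, contr_fcol, hcd]
  · intro p
    rw [sub_col, sub_col, contr_col]
    split_ifs <;> first | rfl | (exfalso; omega) | (congr 1; omega)

theorem contr_contr_par_iso (hM : M + 1 = n + j) (hN : N + 1 = M + l) (hK : K + 1 = n + l)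
    (hN' : N + 1 = K + j) (i a : Fin n) (hia : i < a) (b : Fin M) (hb : (b : ℕ) + 1 = a + j)
    (c : Fin K) (hc : (c : ℕ) = i) (L L' : VCL) (G : EnumGraph VCL FCL N) :
    Isomorphic ((G.contr hN hl b L).contr hM hj i L')
      ((G.contr hN' hj c L').contr hK hl a L) := by
  rw [Fin.lt_def] at hia
  refine iso_of_range
    (fun d => G.contrFlag hN hl b L ((G.contr hN hl b L).contrFlag hM hj i L' d))
    (fun d => G.contrFlag hN' hj c L' ((G.contr hN' hj c L').contrFlag hK hl a L d))
    ((contrFlag_injective hN hl b L G).comp (contrFlag_injective hM hj i L' _))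
    ((contrFlag_injective hN' hj c L' G).comp (contrFlag_injective hK hl a L _)) ?_ ?_ ?_ ?_ ?_
  · intro f
    rw [exists_contr_contr, exists_contr_contr]
    simp only [collapse]
    split_ifs <;> grind
  · intro p d hcd
    rw [contr_pos, contr_pos, contr_pos, contr_pos, hcd]
    simp only [collapse]
    split_ifs <;> omega
  · intro p d hcd
    rw [contr_join, contr_join, contr_join, contr_join, hcd]
  · intro p d hcd
    rw [contr_fcol, contr_fcol, contr_fcol, contr_fcol, hcd]
  · intro p
    rw [contr_col, contr_col, contr_col, contr_col, contr_col, contr_col]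
    split_ifs <;> first | rfl | (exfalso; omega) | (congr 1; omega)

end Laws

section Relabel

open OperadBlock

variable {n j N : ℕ} (h : N + 1 = n + j) (i : Fin n) (σ : Equiv.Perm (Fin n))
  (τ : Equiv.Perm (Fin j))

theorem blockPerm_inr (p : Fin N) (k : Fin j) (hk : (p : ℕ) = i + k) :
    (blockPerm h i σ τ p : ℕ) = σ i + τ k := by
  have hp : p = placeEquiv h i (Sum.inr k) := Fin.ext hk
  rw [hp, blockPerm]
  simp only [Equiv.trans_apply, Equiv.symm_apply_apply, Equiv.sumCongr_apply, Sum.map_inr]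
  rfl

theorem blockPerm_inl (p : Fin N) (a : Fin n) (ha : a ≠ i)
    (hp : (p : ℕ) = if (a : ℕ) < i then (a : ℕ) else a + j - 1) :
    (blockPerm h i σ τ p : ℕ) = if (σ a : ℕ) < σ i then (σ a : ℕ) else σ a + j - 1 := by
  have key : ∀ (i : Fin n) (a : {a : Fin n // a ≠ i}), (placeEquiv h i (Sum.inl a) : ℕ) =
      if (a.1 : ℕ) < i then (a.1 : ℕ) else a.1 + j - 1 := by
    intro i a
    change (place h i (Sum.inl a) : ℕ) = _
    simp only [place]
    split_ifs <;> rfl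
  have hp' : p = placeEquiv h i (Sum.inl ⟨a, ha⟩) := Fin.ext (by rw [hp, key])
  rw [hp', blockPerm]
  simp only [Equiv.trans_apply, Equiv.symm_apply_apply, Equiv.sumCongr_apply, Sum.map_inl]
  rw [key]
  rfl

theorem blockPerm_mem (p : Fin N) :
    ((σ i : ℕ) ≤ blockPerm h i σ τ p ∧ (blockPerm h i σ τ p : ℕ) < σ i + j) ↔
      ((i : ℕ) ≤ p ∧ (p : ℕ) < i + j) := by
  by_cases hc : (i : ℕ) ≤ p ∧ (p : ℕ) < i + j
  · rw [blockPerm_inr h i σ τ p ⟨p - i, by omega⟩ (by simp only; omega)]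
    have := (τ ⟨p - i, by omega⟩).2
    constructor <;> intro <;> omega
  · have hp := p.2
    let a : Fin n := ⟨collapse i j p, by simp only [collapse]; split_ifs <;> omega⟩
    have hav : (a : ℕ) = collapse i j p := rfl
    have ha : a ≠ i := fun e => by
      have := congrArg Fin.val e
      rw [hav, collapse] at this
      split_ifs at this <;> omega
    rw [blockPerm_inl h i σ τ p a ha (by
      rw [hav, collapse]
      split_ifs <;> omega)]
    have h1 : (σ a : ℕ) ≠ σ i := fun e => ha (σ.injective (Fin.ext e))
    constructor
    · intro hh
      split_ifs at hh <;> omega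
    · intro hh
      exact absurd hh hc

theorem collapse_blockPerm (hj : 0 < j) (p : Fin N) (a : Fin n) (hav : (a : ℕ) = collapse i j p) :
    collapse (σ i) j (blockPerm h i σ τ p) = σ a := by
  have hm := blockPerm_mem h i σ τ p
  by_cases hc : (i : ℕ) ≤ p ∧ (p : ℕ) < i + j
  · have : a = i := Fin.ext (by rw [hav, collapse]; split_ifs <;> omega)
    subst this
    have := hm.2 hc
    rw [collapse]
    split_ifs <;> omega
  · have ha : a ≠ i := fun e => by
      have := congrArg Fin.val e
      rw [hav, collapse] at this
      split_ifs at this <;> omega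
    rw [blockPerm_inl h i σ τ p a ha (by
      rw [hav, collapse]
      split_ifs <;> omega)]
    have h1 : (σ a : ℕ) ≠ σ i := fun e => ha (σ.injective (Fin.ext e))
    rw [collapse]
    split_ifs <;> omega

theorem relabel_sub_iso (G : EnumGraph VCL FCL N) :
    Isomorphic ((G.sub h i).relabel τ) ((G.relabel (blockPerm h i σ τ)).sub h (σ i)) := by
  have hpos : ∀ f : G.Flag, (G.relabel (blockPerm h i σ τ)).pos f
      = blockPerm h i σ τ (G.enu (G.att f)) := fun _ => rfl
  have hmem : ∀ f : G.Flag, ((σ i : ℕ) ≤ (G.relabel (blockPerm h i σ τ)).pos f ∧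
      (G.relabel (blockPerm h i σ τ)).pos f < σ i + j) ↔ (i ≤ G.pos f ∧ G.pos f < i + j) :=
    fun f => blockPerm_mem h i σ τ (G.enu (G.att f))
  refine iso_of_range (A := G.Flag) (G.subFlag h i)
    ((G.relabel (blockPerm h i σ τ)).subFlag h (σ i)) (subFlag_injective h i G)
    (subFlag_injective h (σ i) _) ?_ ?_ ?_ ?_ ?_
  · intro f
    refine (exists_subFlag h i G f).trans (Iff.trans ?_ (exists_subFlag h (σ i)
      (G.relabel (blockPerm h i σ τ)) f).symm)
    exact (hmem f).symm
  · intro c d hcd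
    have h1 := sub_flag h i G c
    have h2 := sub_pos h i G c
    rw [sub_pos, ← hcd]
    change (τ ((G.sub h i).enu ((G.sub h i).att c)) : ℕ) = _
    have h3 := blockPerm_inr h i σ τ (G.enu (G.att (G.subFlag h i c)))
      ((G.sub h i).enu ((G.sub h i).att c)) (by
        change G.pos _ = _ + (G.sub h i).pos c
        omega)
    have h4 := hpos (G.subFlag h i c)
    omega
  · intro c d hcd
    refine (sub_join h i G c).trans (Eq.trans ?_ (sub_join h (σ i) _ d).symm)
    rw [← hcd]
    have := hmem (G.join (G.subFlag h i c))
    by_cases hc : i ≤ G.pos (G.join (G.subFlag h i c)) ∧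
      G.pos (G.join (G.subFlag h i c)) < i + j
    · rw [if_pos hc]
      exact (if_pos (this.2 hc)).symm
    · rw [if_neg hc]
      exact (if_neg (fun e => hc (this.1 e))).symm
  · intro c d hcd
    exact congrArg G.fcol hcd
  · intro c
    by_cases hc : c < j
    · obtain ⟨a, ha⟩ := τ.surjective ⟨c, hc⟩
      have hca : c = τ a := by rw [ha]
      rw [hca, relabel_col, sub_col, sub_col, if_pos a.2, if_pos (τ a).2]
      rw [← blockPerm_inr h i σ τ ⟨i + a, by omega⟩ a rfl, relabel_col]
    · rw [col_none _ _ (by omega), col_none _ _ (by omega)]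

theorem relabel_contr_iso (hj : 0 < j) (L : VCL) (G : EnumGraph VCL FCL N) :
    Isomorphic ((G.contr h hj i L).relabel σ)
      ((G.relabel (blockPerm h i σ τ)).contr h hj (σ i) L) := by
  have hmem : ∀ f : G.Flag, ((σ i : ℕ) ≤ (G.relabel (blockPerm h i σ τ)).pos f ∧
      (G.relabel (blockPerm h i σ τ)).pos f < σ i + j) ↔ (i ≤ G.pos f ∧ G.pos f < i + j) :=
    fun f => blockPerm_mem h i σ τ (G.enu (G.att f))
  refine iso_of_range (A := G.Flag) (G.contrFlag h hj i L)
    ((G.relabel (blockPerm h i σ τ)).contrFlag h hj (σ i) L) (contrFlag_injective h hj i L G)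
    (contrFlag_injective h hj (σ i) L _) ?_ ?_ ?_ ?_ ?_
  · intro f
    refine (exists_contrFlag h hj i L G f).trans
      (Iff.trans ?_ (exists_contrFlag h hj (σ i) L (G.relabel (blockPerm h i σ τ)) f).symm)
    have h1 := hmem f
    have h2 := hmem (G.join f)
    exact imp_congr (and_congr h1.symm h2.symm) Iff.rfl
  · intro c d hcd
    rw [contr_pos, ← hcd]
    exact (collapse_blockPerm h i σ τ hj (G.enu (G.att (G.contrFlag h hj i L c)))
      ((G.contr h hj i L).enu ((G.contr h hj i L).att c)) (contr_pos h hj i L G c)).symm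
  · intro c d hcd
    exact congrArg G.join hcd
  · intro c d hcd
    exact congrArg G.fcol hcd
  · intro c
    by_cases hc : c < n
    · obtain ⟨a, ha⟩ := σ.surjective ⟨c, hc⟩
      have hca : c = σ a := by rw [ha]
      rw [hca, relabel_col, contr_col, contr_col]
      by_cases hai : a = i
      · subst hai
        simp
      · have h1 : (σ a : ℕ) ≠ σ i := fun e => hai (σ.injective (Fin.ext e))
        have h2 : (a : ℕ) ≠ i := fun e => hai (Fin.ext e)
        have h3 := blockPerm_inl h i σ τ
          ⟨if (a : ℕ) < i then (a : ℕ) else a + j - 1, by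
            split_ifs <;> omega⟩ a hai rfl
        have h4 := relabel_col (blockPerm h i σ τ) G
          ⟨if (a : ℕ) < i then (a : ℕ) else a + j - 1, by
            split_ifs <;> omega⟩
        rw [h3] at h4
        rw [if_neg h1, if_neg h2]
        rw [apply_ite (G.relabel (blockPerm h i σ τ)).col, apply_ite G.col] at h4
        exact h4.symm
    · rw [col_none _ _ (by omega), col_none _ _ (by omega)]

end Relabel

end EnumGraph

/-! ## The contraction operad -/

/-- The set of isomorphism classes of enumerated colored graphs with `n` vertices. -/
def Dgm (VCL : Type u) (FCL : Type v) (n : ℕ) : Type (max 1 u v) :=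
  Quotient (EnumGraph.setoid VCL FCL n)

namespace Dgm

variable {VCL : Type u} {FCL : Type v}

/-- The class of a graph. -/
def mk {n : ℕ} (G : EnumGraph VCL FCL n) : Dgm VCL FCL n := Quotient.mk _ G

/-- Renumbering the vertices by `σ`. -/
def relabel {n : ℕ} (σ : Equiv.Perm (Fin n)) : Dgm VCL FCL n → Dgm VCL FCL n :=
  Quotient.map (EnumGraph.relabel σ) (fun _ _ e => EnumGraph.relabel_iso σ e)

/-- The class of `Γ_J` for `J` the set of vertices with numbers `i, …, i + j - 1`. -/
noncomputable def sub {n j N : ℕ} (h : N + 1 = n + j) (i : Fin n) :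
    Dgm VCL FCL N → Dgm VCL FCL j :=
  Quotient.map (EnumGraph.sub h i) (fun _ _ e => EnumGraph.sub_iso h i e)

/-- The class of `Γ/(J,L)` for `J` the set of vertices with numbers `i, …, i + j - 1`. -/
noncomputable def contr {n j N : ℕ} (h : N + 1 = n + j) (hj : 0 < j) (i : Fin n) (L : VCL) :
    Dgm VCL FCL N → Dgm VCL FCL n :=
  Quotient.map (EnumGraph.contr h hj i L) (fun _ _ e => EnumGraph.contr_iso h hj i L e)

end Dgm

/-- The space `U(n)` of contraction maps. As `VCL` is finite, a linear map
`Q : k^(Dgm n) → k^(VCL)` is the family of its coefficients `q (Γ, L)`, where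
`Q Γ = ∑ L, q (Γ, L) L`. -/
abbrev ContractionMap (k : Type w) (VCL : Type u) (FCL : Type v) (n : ℕ) :
    Type (max 1 u v w) :=
  Dgm VCL FCL n → VCL → k

/-- The symmetric operad `U` of contraction maps. The partial composition is
`(Q'' ∘ᵢ Q') Γ = ∑ L, q' (Γ_J, L) Q'' (Γ/(J,L))`, where `J` consists of the vertices of `Γ` with
numbers `i, …, i + j - 1`, and `(Q · σ) Γ = Q (σ Γ)`, where the vertex with number `a` in `Γ` has
number `σ a` in `σ Γ`. -/
noncomputable def contractionOperad (k : Type w) [CommRing k] (VCL : Type u) [Fintype VCL]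
    (FCL : Type v) : SymmetricOperad.{w, max 1 u v w} k where
  Op n := ContractionMap k VCL FCL n
  act σ :=
    { toFun := fun Q D => Q (D.relabel σ)
      map_add' := fun _ _ => rfl
      map_smul' := fun _ _ => rfl }
  comp {n j N} h i := LinearMap.mk₂ k
    (fun (Q'' : ContractionMap k VCL FCL n) (Q' : ContractionMap k VCL FCL j)
        (D : Dgm VCL FCL N) (K : VCL) =>
      ∑ L : VCL, Q' (D.sub h i) L * Q'' (D.contr h j.pos i L) K)
    (fun _ _ _ => by funext D K; simp [mul_add, Finset.sum_add_distrib])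
    (fun _ _ _ => by funext D K; simp [Finset.mul_sum, mul_left_comm])
    (fun _ _ _ => by funext D K; simp [add_mul, Finset.sum_add_distrib])
    (fun _ _ _ => by funext D K; simp [Finset.mul_sum, mul_assoc])
  act_one f := by
    funext D
    induction D using Quotient.inductionOn
    rfl
  act_mul σ τ f := by
    funext D
    induction D using Quotient.inductionOn
    rfl
  act_comp {n j N} h i σ τ f g := by
    funext D K
    induction D using Quotient.inductionOn with | h G
    refine Finset.sum_congr rfl fun L _ => ?_
    exact congrArg₂ (fun a b => g a L * f b K)
      (Quotient.sound (EnumGraph.relabel_sub_iso h i σ τ G))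
      (Quotient.sound (EnumGraph.relabel_contr_iso h i σ τ j.pos L G))
  assoc_seq {n j l M K N} hM hN hK hN' i a b hb f g e := by
    funext D X
    induction D using Quotient.inductionOn with | h G
    have e1 : (Dgm.mk G).sub hN b = ((Dgm.mk G).sub hN' i).sub hK a :=
      Quotient.sound (EnumGraph.sub_sub_iso hN hK hN' i a b hb G)
    have e2 : ∀ L, ((Dgm.mk G).contr hN l.pos b L).sub hM i
        = ((Dgm.mk G).sub hN' i).contr hK l.pos a L := fun L =>
      Quotient.sound (EnumGraph.contr_sub_iso l.pos hM hN hK hN' i a b hb L G)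
    have e3 : ∀ L L', ((Dgm.mk G).contr hN l.pos b L).contr hM j.pos i L'
        = (Dgm.mk G).contr hN' K.pos i L' := fun L L' =>
      Quotient.sound (EnumGraph.contr_contr_iso j.pos l.pos hM hN hK hN' K.pos i a b hb L L' G)
    change ∑ L, e ((Dgm.mk G).sub hN b) L *
        ∑ L', g (((Dgm.mk G).contr hN l.pos b L).sub hM i) L' *
          f (((Dgm.mk G).contr hN l.pos b L).contr hM j.pos i L') X =
      ∑ L', (∑ L, e (((Dgm.mk G).sub hN' i).sub hK a) L *
          g (((Dgm.mk G).sub hN' i).contr hK l.pos a L) L') *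
        f ((Dgm.mk G).contr hN' K.pos i L') X
    simp only [e2, e3, Finset.mul_sum, Finset.sum_mul, mul_assoc]
    rw [Finset.sum_comm]
    refine Finset.sum_congr rfl fun L' _ => Finset.sum_congr rfl fun L _ => ?_
    rw [e1]
  assoc_par {n j l M K N} hM hN hK hN' i a hia b hb c hc f g e := by
    funext D X
    induction D using Quotient.inductionOn with | h G
    have e1 : ∀ L, ((Dgm.mk G).contr hN l.pos b L).sub hM i = (Dgm.mk G).sub hN' c := fun L =>
      Quotient.sound (EnumGraph.contr_sub_left_iso l.pos hM hN hN' i a hia b hb c hc L G)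
    have e2 : ∀ L, (Dgm.mk G).sub hN b = ((Dgm.mk G).contr hN' j.pos c L).sub hK a := fun L =>
      Quotient.sound (EnumGraph.contr_sub_right_iso j.pos hN hK hN' i a hia b hb c hc L G)
    have e3 : ∀ L L', ((Dgm.mk G).contr hN l.pos b L).contr hM j.pos i L'
        = ((Dgm.mk G).contr hN' j.pos c L').contr hK l.pos a L := fun L L' =>
      Quotient.sound
        (EnumGraph.contr_contr_par_iso j.pos l.pos hM hN hK hN' i a hia b hb c hc L L' G)
    change ∑ L, e ((Dgm.mk G).sub hN b) L *
        ∑ L', g (((Dgm.mk G).contr hN l.pos b L).sub hM i) L' *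
          f (((Dgm.mk G).contr hN l.pos b L).contr hM j.pos i L') X =
      ∑ L', g ((Dgm.mk G).sub hN' c) L' *
        ∑ L, e (((Dgm.mk G).contr hN' j.pos c L').sub hK a) L *
          f (((Dgm.mk G).contr hN' j.pos c L').contr hK l.pos a L) X
    simp only [e1, e3, ← e2, Finset.mul_sum]
    rw [Finset.sum_comm]
    refine Finset.sum_congr rfl fun L' _ => Finset.sum_congr rfl fun L _ => ?_
    rw [mul_left_comm]

/-- The space `U_Adm(n)` of the contraction maps `Q` with `Q Γ = 0` for every graph `Γ` that is not
`Adm`-admissible or has tadpoles. -/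
def admissibleMaps (k : Type w) [CommRing k] (VCL : Type u) [Fintype VCL] {FCL : Type v}
    (Adm : Set (FCL × FCL)) (n : ℕ+) : Set ((contractionOperad k VCL FCL).Op n) :=
  {Q : ContractionMap k VCL FCL n | ∀ G : EnumGraph VCL FCL n,
    ¬ G.IsAdmissible Adm ∨ G.HasTadpole → Q (Dgm.mk G) = 0}

/-! Let `J` be a block of vertices of `Γ`. An inner edge of `Γ` with both ends in `J` is an inner
edge of `Γ_J`. Any other inner edge survives the contraction and is an inner edge of `Γ/(J,L)`, for
every color `L`. In both cases the edge keeps the colors of its two flags, and if its two ends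
coincide in `Γ`, they still do. So a forbidden pair of colors or a tadpole in `Γ` shows up in `Γ_J`
or in `Γ/(J,L)`, and each summand `q'(Γ_J,L) Q''(Γ/(J,L))` has a vanishing factor. This gives
stability under composition (`sub_or_contr_of_ne` and its two consequences). Linearity is immediate,
and renumbering does not affect edges or colors.

The unit `e` sends a one-vertex graph without tadpoles to the color of its vertex, and one with
tadpoles to zero. It lies in the suboperad because every inner edge of a one-vertex graph is a
tadpole, so that inadmissibility also forces a tadpole.

For `e ∘ Q` the block is the whole graph: `Γ_J ≅ Γ`, while `Γ/(J,L)` is a single vertex of color `L`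
without inner edges, on which `e` has the value `L`. The sum is therefore `∑ q(Γ,L) L = Q(Γ)`.

For `Q ∘ᵢ e` the block is one vertex. If it carries no tadpole, only its own color contributes, and
contracting it to that color changes nothing (`contr_one_iso`). If it carries a tadpole, `e` kills
every term, and `Q(Γ) = 0` because `Γ` has this tadpole as well. Contraction would erase the
tadpole, which is why the vanishing condition on tadpoles is needed for this `e` to be a right unit.
-/

namespace EnumGraph

variable {VCL : Type u} {FCL : Type v}

/-! ### Inner edges and tadpoles under restriction to a block and contraction -/

/-- Expresses tadpoles by positions of flags, for which restriction and contraction have the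
explicit formulas `sub_pos` and `contr_pos`. -/
theorem att_eq_iff_pos_eq {n : ℕ} (G : EnumGraph VCL FCL n) (f g : G.Flag) :
    G.att f = G.att g ↔ G.pos f = G.pos g :=
  (Fin.val_injective.comp G.enu.injective).eq_iff.symm

theorem pos_lt {n : ℕ} (G : EnumGraph VCL FCL n) (f : G.Flag) : G.pos f < n := (G.enu (G.att f)).2

/-- Needed because the unit is a function of isomorphism classes, while tadpoles are defined on
representatives. -/
theorem hasTadpole_of_isomorphic {n : ℕ} {G H : EnumGraph VCL FCL n} (e : Isomorphic G H)
    (hG : G.HasTadpole) : H.HasTadpole := by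
  obtain ⟨jf, h1, h2, -, -⟩ := pos_of_iso e
  obtain ⟨f, hf, ha⟩ := hG
  refine ⟨jf f, ?_, ?_⟩
  · rw [← h2]
    exact jf.injective.ne hf
  · rw [att_eq_iff_pos_eq] at ha ⊢
    rw [← h2, h1, h1, ha]

/-- An inner edge of `G` is an inner edge of the subgraph on a block, if both ends are in the block,
and an inner edge of the contraction of the block otherwise. -/
theorem sub_or_contr_of_ne {n j N : ℕ} (h : N + 1 = n + j) (hj : 0 < j) (i : Fin n) (L : VCL)
    (G : EnumGraph VCL FCL N) (f : G.Flag) (hf : f ≠ G.join f) :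
    (∃ a : (G.sub h i).Flag, G.subFlag h i a = f ∧ G.subFlag h i ((G.sub h i).join a) = G.join f) ∨
      ∃ a : (G.contr h hj i L).Flag, G.contrFlag h hj i L a = f ∧
        G.contrFlag h hj i L ((G.contr h hj i L).join a) = G.join f := by
  by_cases hc : (i ≤ G.pos f ∧ G.pos f < i + j) ∧
      (i ≤ G.pos (G.join f) ∧ G.pos (G.join f) < i + j)
  · obtain ⟨a, rfl⟩ := (exists_subFlag h i G f).2 hc.1
    exact Or.inl ⟨a, rfl, by rw [sub_join, if_pos hc.2]⟩
  -- The flags that survive contraction are described by an implication whose premise is that both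
  -- ends lie in the block; here this premise fails.
  · obtain ⟨a, rfl⟩ := (exists_contrFlag h hj i L G f).2 fun e => absurd e hc
    exact Or.inr ⟨a, rfl, contr_join h hj i L G a⟩

/-- Flag colors are inherited, so an edge with a forbidden pair of colors violates admissibility in
whichever of the two graphs contains it. -/
theorem not_isAdmissible_sub_or_contr {n j N : ℕ} (h : N + 1 = n + j) (hj : 0 < j) (i : Fin n)
    (L : VCL) {Adm : Set (FCL × FCL)} {G : EnumGraph VCL FCL N} (hG : ¬ G.IsAdmissible Adm) :
    ¬ (G.sub h i).IsAdmissible Adm ∨ ¬ (G.contr h hj i L).IsAdmissible Adm := by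
  by_contra! hcon
  refine hG fun f hf => ?_
  rcases sub_or_contr_of_ne h hj i L G f hf with ⟨a, ha, ha'⟩ | ⟨a, ha, ha'⟩
  · rw [← ha', ← ha, ← sub_fcol, ← sub_fcol]
    -- The edge stays an inner edge: a fixed flag `a` of the new involution would give `f = G.join
    -- f`.
    exact hcon.1 a fun e => hf (by rw [← ha', ← e, ha])
  · rw [← ha', ← ha, ← contr_fcol, ← contr_fcol]
    exact hcon.2 a fun e => hf (by rw [← ha', ← e, ha])

/-- The position of a flag in either graph is a function of its position in `G` (a shift by `i`, or
`collapse`), so equal positions remain equal. -/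
theorem hasTadpole_sub_or_contr {n j N : ℕ} (h : N + 1 = n + j) (hj : 0 < j) (i : Fin n)
    (L : VCL) {G : EnumGraph VCL FCL N} (hG : G.HasTadpole) :
    (G.sub h i).HasTadpole ∨ (G.contr h hj i L).HasTadpole := by
  obtain ⟨f, hf, hat⟩ := hG
  rw [att_eq_iff_pos_eq] at hat
  rcases sub_or_contr_of_ne h hj i L G f hf with ⟨a, ha, ha'⟩ | ⟨a, ha, ha'⟩
  · refine Or.inl ⟨a, fun e => hf (by rw [← ha', ← e, ha]), ?_⟩
    rw [att_eq_iff_pos_eq, sub_pos, sub_pos, ha, ha', hat]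
  · refine Or.inr ⟨a, fun e => hf (by rw [← ha', ← e, ha]), ?_⟩
    rw [att_eq_iff_pos_eq, contr_pos, contr_pos, ha, ha', hat]

/-! ### One-vertex graphs, and blocks consisting of all vertices or of a single one -/

/-- With only one vertex, both ends of any inner edge coincide. Without tadpoles there are thus no
inner edges, and admissibility is vacuous. -/
theorem isAdmissible_of_not_hasTadpole {Adm : Set (FCL × FCL)} {G : EnumGraph VCL FCL 1}
    (hG : ¬ G.HasTadpole) : G.IsAdmissible Adm := fun f hf =>
  absurd ⟨f, hf, G.enu.injective (Subsingleton.elim _ _)⟩ hG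

/-- The subgraph on all vertices is the whole graph. -/
theorem sub_self_iso {N : ℕ} (h : N + 1 = 1 + N) (i : Fin 1) (G : EnumGraph VCL FCL N) :
    Isomorphic (G.sub h i) G := by
  -- The block is now `0, …, N - 1`, so it contains every vertex and no flag or edge is lost.
  obtain rfl : i = 0 := Subsingleton.elim _ _
  refine iso_of_range (A := G.Flag) (G.subFlag h 0) id (subFlag_injective h 0 G)
    Function.injective_id ?_ ?_ ?_ ?_ ?_
  · intro f
    rw [exists_subFlag]
    have := G.pos_lt f
    exact iff_of_true ⟨Nat.zero_le _, by simpa using this⟩ ⟨f, rfl⟩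
  · rintro c d rfl
    simp [sub_pos]
  · rintro c d rfl
    rw [sub_join, if_pos ⟨Nat.zero_le _, by simpa using G.pos_lt _⟩]
    rfl
  · rintro c d rfl
    exact sub_fcol h 0 G c
  · intro a
    rw [sub_col]
    split_ifs with ha
    · simp
    · rw [col_none _ _ (by omega)]

/-- Contracting all vertices leaves a graph without tadpoles. -/
theorem not_hasTadpole_contr_self {N : ℕ} (h : N + 1 = 1 + N) (hN : 0 < N) (i : Fin 1) (L : VCL)
    (G : EnumGraph VCL FCL N) : ¬ (G.contr h hN i L).HasTadpole := by
  obtain rfl : i = 0 := Subsingleton.elim _ _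
  -- In fact no inner edge at all survives: every flag and its partner lie in the block, so
  -- `contr_flag` forces a surviving flag to be external.
  rintro ⟨f, hf, -⟩
  refine hf (contrFlag_injective h hN 0 L G ?_)
  rw [contr_join]
  exact contr_flag h hN 0 L G f ⟨⟨Nat.zero_le _, by simpa using G.pos_lt _⟩,
    ⟨Nat.zero_le _, by simpa using G.pos_lt _⟩⟩

theorem contr_self_col {N : ℕ} (h : N + 1 = 1 + N) (hN : 0 < N) (i : Fin 1) (L : VCL)
    (G : EnumGraph VCL FCL N) : (G.contr h hN i L).col 0 = some L := by
  obtain rfl : i = 0 := Subsingleton.elim _ _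
  simp [contr_col]

/-- A tadpole of a subgraph is a tadpole of the graph. -/
theorem hasTadpole_of_sub {n j N : ℕ} (h : N + 1 = n + j) (i : Fin n) {G : EnumGraph VCL FCL N}
    (hG : (G.sub h i).HasTadpole) : G.HasTadpole := by
  obtain ⟨a, ha, hat⟩ := hG
  have hj := sub_join h i G a
  have hne := (subFlag_injective h i G).ne ha
  -- A flag whose partner lies outside the block becomes external in the subgraph, so for an inner
  -- edge only the first case is possible.
  split_ifs at hj with hc
  · refine ⟨G.subFlag h i a, hj ▸ hne, ?_⟩
    rw [att_eq_iff_pos_eq] at hat ⊢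
    -- Both positions are at least `i` (by `h1` and `hc`), so the truncated subtraction of `i` can
    -- be cancelled.
    have h1 := sub_flag h i G a
    rw [sub_pos, sub_pos, hj] at hat
    omega
  · exact absurd hj.symm hne

/-- Contracting a vertex without tadpoles to a vertex of the same color does not change the
graph. -/
theorem contr_one_iso {n : ℕ} (h : n + 1 = n + 1) (i : Fin n) (L : VCL) (G : EnumGraph VCL FCL n)
    (hG : ¬ (G.sub h i).HasTadpole) (hL : (G.sub h i).col 0 = some L) :
    Isomorphic (G.contr h one_pos i L) G := by
  -- Replacing the single number `i` by `i` moves no position.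
  have hcollapse : ∀ p : ℕ, collapse i 1 p = p := fun p => by
    rw [collapse]
    split_ifs <;> omega
  refine iso_of_range (A := G.Flag) (G.contrFlag h one_pos i L) id
    (contrFlag_injective h one_pos i L G) Function.injective_id ?_ ?_ ?_ ?_ ?_
  · intro f
    rw [exists_contrFlag]
    -- Contraction could only remove inner edges with both ends at the vertex `i`; such an edge
    -- would be a tadpole of the one-vertex graph `G.sub h i`.
    refine iff_of_true (fun hf => ?_) ⟨f, rfl⟩
    obtain ⟨a, rfl⟩ := (exists_subFlag h i G f).2 hf.1
    by_contra hne
    refine hG ⟨a, fun e => hne ?_, (G.sub h i).enu.injective (Subsingleton.elim _ _)⟩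
    have := sub_join h i G a
    rw [if_pos hf.2, ← e] at this
    exact this
  · rintro c d rfl
    rw [contr_pos, hcollapse]
  · rintro c d rfl
    exact contr_join h one_pos i L G c
  · rintro c d rfl
    exact contr_fcol h one_pos i L G c
  · intro a
    rw [contr_col]
    rw [sub_col, if_pos one_pos, add_zero] at hL
    split_ifs with h1 h2
    · rfl
    -- The contracted vertex receives the color `L`, which by `hL` is the color that the vertex `i`
    -- had.
    · rw [h2, hL]
    · rfl

end EnumGraph

/-! ### The unit as a map on isomorphism classes -/

open Classical in
/-- The unit of the contraction operad: it sends a graph with one vertex and without tadpoles to the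
color of its vertex, and a graph with tadpoles to zero. -/
noncomputable def contractionUnit (k : Type w) [CommRing k] (VCL : Type u) (FCL : Type v) :
    ContractionMap k VCL FCL 1 := fun D K =>
  if ∃ G : EnumGraph VCL FCL 1, Dgm.mk G = D ∧ ¬ G.HasTadpole ∧ G.col 0 = some K then 1 else 0

open Classical in
-- Having no tadpole and having a vertex of color `K` are invariant under isomorphism, so the
-- existence of some representative with these properties is equivalent to `G` itself having them.
theorem contractionUnit_mk {k : Type w} [CommRing k] {VCL : Type u} {FCL : Type v}
    (G : EnumGraph VCL FCL 1) (K : VCL) : contractionUnit k VCL FCL (Dgm.mk G) K =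
      if ¬ G.HasTadpole ∧ G.col 0 = some K then 1 else 0 := by
  refine if_congr ⟨?_, fun hG => ⟨G, rfl, hG⟩⟩ rfl rfl
  rintro ⟨H, hHG, hH, hc⟩
  have e : EnumGraph.Isomorphic H G := Quotient.exact hHG
  obtain ⟨-, -, -, -, h4⟩ := EnumGraph.pos_of_iso e
  exact ⟨fun hG => hH (EnumGraph.hasTadpole_of_isomorphic ((EnumGraph.isomorphic_equivalence 1).symm e) hG),
    h4 0 ▸ hc⟩

/-! ### Closure under the operad structure, and the unit laws -/

section Operad

variable {k : Type w} [CommRing k] {VCL : Type u} [Fintype VCL] {FCL : Type v}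

theorem contractionOperad_comp_mk {n j N : ℕ+} (h : (N : ℕ) + 1 = n + j) (i : Fin n)
    (Q : ContractionMap k VCL FCL n) (R : ContractionMap k VCL FCL j) (G : EnumGraph VCL FCL N)
    (K : VCL) : (contractionOperad k VCL FCL).comp h i Q R (Dgm.mk G) K =
      ∑ L : VCL, R (Dgm.mk (G.sub h i)) L * Q (Dgm.mk (G.contr h j.pos i L)) K := rfl

theorem admissibleMaps_isSuboperad (Adm : Set (FCL × FCL)) :
    (contractionOperad k VCL FCL).IsSuboperad (admissibleMaps k VCL Adm) where
  zero_mem _ _ _ := rfl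
  add_mem _ f hf g hg G hG := (congrArg₂ (· + ·) (hf G hG) (hg G hG)).trans (add_zero _)
  smul_mem _ c f hf G hG := (congrArg (c • ·) (hf G hG)).trans (smul_zero c)
  -- Renumbering leaves the underlying colored graph untouched, so `hG` serves as the same condition
  -- on `G.relabel σ`.
  act_mem _ σ _ hf G hG := hf (G.relabel σ) hG
  comp_mem n j N h i f hf g hg G hG := by
    funext K
    refine (contractionOperad_comp_mk h i f g G K).trans ?_
    refine Finset.sum_eq_zero fun L _ => ?_
    -- The defect of `G` passes to one of the two factors, separately for each summand `L`.
    have key : (¬ (G.sub h i).IsAdmissible Adm ∨ (G.sub h i).HasTadpole) ∨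
        (¬ (G.contr h j.pos i L).IsAdmissible Adm ∨ (G.contr h j.pos i L).HasTadpole) := by
      rcases hG with hG | hG
      · exact (EnumGraph.not_isAdmissible_sub_or_contr h j.pos i L hG).imp Or.inl Or.inl
      · exact (EnumGraph.hasTadpole_sub_or_contr h j.pos i L hG).imp Or.inr Or.inr
    rcases key with hc | hc
    · rw [hg _ hc, Pi.zero_apply, zero_mul]
    · rw [hf _ hc, Pi.zero_apply, mul_zero]

theorem contractionUnit_isUnitOn (Adm : Set (FCL × FCL)) :
    (contractionOperad k VCL FCL).IsUnitOn (admissibleMaps k VCL Adm)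
      (contractionUnit k VCL FCL) where
  mem G hG := by
    classical
    funext K
    have ht : G.HasTadpole :=
      hG.elim (fun h => by_contra fun ht => h (EnumGraph.isAdmissible_of_not_hasTadpole ht)) id
    exact (contractionUnit_mk G K).trans (if_neg fun hc => hc.1 ht)
  unit_comp n h i f _ := by
    classical
    funext D K
    induction D using Quotient.inductionOn with | h G
    refine (contractionOperad_comp_mk h i (contractionUnit k VCL FCL) f G K).trans ?_
    have hs : Dgm.mk (G.sub h i) = Dgm.mk G := Quotient.sound (EnumGraph.sub_self_iso h i G)
    -- After contraction of everything the only vertex has the color `L` and there are no tadpoles,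
    -- so the unit returns the basis vector `L`.
    have hu : ∀ L, contractionUnit k VCL FCL (Dgm.mk (G.contr h n.pos i L)) K =
        if L = K then 1 else 0 := fun L => by
      refine (contractionUnit_mk _ K).trans (if_congr ?_ rfl rfl)
      have hc : (G.contr h n.pos i L).col 0 = some L := EnumGraph.contr_self_col h n.pos i L G
      exact ⟨fun e => Option.some.inj (hc.symm.trans e.2), fun e =>
        ⟨EnumGraph.not_hasTadpole_contr_self h n.pos i L G, e ▸ hc⟩⟩
    rw [hs]
    refine (Finset.sum_congr rfl fun L _ => congrArg _ (hu L)).trans ?_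
    simp [Dgm.mk]
  comp_unit n h i f hf := by
    classical
    funext D K
    induction D using Quotient.inductionOn with | h G
    refine (contractionOperad_comp_mk h i f (contractionUnit k VCL FCL) G K).trans ?_
    refine (Finset.sum_congr rfl fun L _ =>
      congrArg (· * _) (contractionUnit_mk (G.sub h i) L)).trans ?_
    by_cases ht : (G.sub h i).HasTadpole
    -- Here membership of `f` in the suboperad is essential: all summands vanish, and `f` must
    -- vanish on `G` too.
    · have h0 : f (Dgm.mk G) = 0 := hf G (Or.inr (EnumGraph.hasTadpole_of_sub h i ht))
      refine Eq.trans ?_ (congrFun h0 K).symm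
      exact Finset.sum_eq_zero fun L _ => by rw [if_neg fun hc => hc.1 ht, zero_mul]
    · obtain ⟨L, hL⟩ : ∃ L, (G.sub h i).col 0 = some L :=
        ⟨_, EnumGraph.col_eq _ ((G.sub h i).enu.symm 0) 0 (by simp)⟩
      have hc : Dgm.mk (G.contr h one_pos i L) = Dgm.mk G :=
        Quotient.sound (EnumGraph.contr_one_iso h i L G ht hL)
      -- The unit selects the color `L` of the vertex `i`; for this color the contraction is
      -- isomorphic to `G`.
      rw [Finset.sum_eq_single L]
      · rw [if_pos ⟨ht, hL⟩, one_mul]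
        exact congrFun (congrArg f hc) K
      · intro L' _ hne
        rw [if_neg fun hc => hne (Option.some.inj (hc.2.symm.trans hL)), zero_mul]
      · exact fun hn => absurd (Finset.mem_univ L) hn

end Operad

theorem mainTheorem10 {k : Type w} [CommRing k] {VCL : Type u} [Fintype VCL] {FCL : Type v}
    (Adm : Set (FCL × FCL)) (hAdm : ∀ φ ψ : FCL, (φ, ψ) ∈ Adm → (ψ, φ) ∈ Adm) :
    (contractionOperad k VCL FCL).IsSuboperad (admissibleMaps k VCL Adm) ∧
      ∃ e, (contractionOperad k VCL FCL).IsUnitOn (admissibleMaps k VCL Adm) e := by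
  exact ⟨admissibleMaps_isSuboperad Adm, contractionUnit k VCL FCL, contractionUnit_isUnitOn Adm⟩
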